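/- Let $T$ be a (possibly many-sorted) first-order theory and let $\mathbb{U}$ be a monster model of $T$, i.e. a model that is $\kappa$-saturated and strongly $\kappa$-homogeneous for some uncountable cardinal $\kappa$ larger than the number of sorts and symbols of the language. Write $\operatorname{dcl}^{eq}$ and $\operatorname{acl}^{eq}$ for definable and algebraic closure in $\mathbb{U}^{eq}$; "definable" means definable with parameters, and "$A$-definable" means definable with parameters from $A \subseteq \mathbb{U}^{eq}$. Types are global: a definable type is a complete type $p(x)$ over $\mathbb{U}$ such that for every formula $\varphi(x,y)$ the set $d_p\varphi = \{b : \varphi(x,b) \in p\}$ is definable, and $p$ is $A$-definable if all the sets $d_p\varphi$ are $A$-definable. For a definable set $X$, $\ulcorner X\urcorner$ denotes a code (canonical parameter) of $X$ in $\mathbb{U}^{eq}$, and for a definable type $p$, $\ulcorner p\urcorner$ denotes the set of codes of all the sets $d_p\varphi$. Two sets or tuples of elements of $\mathbb{U}^{eq}$ are interdefinable if each is contained in the $\operatorname{dcl}^{eq}$ of the other. Let $K$ be a home sort of $T$, i.e. a sort with $\mathbb{U}^{eq} = \operatorname{dcl}^{eq}(K)$, and let $\mathcal{G}$ be a collection of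 sorts of $\mathbb{U}^{eq}$. Suppose that (i) for every non-empty definable set $X \subseteq K^1$ there is an $\operatorname{acl}^{eq}(\ulcorner X\urcorner)$-definable type $p$ in $X$ (that is, a type $p$ in the sort $K$ containing the formula $x \in X$); (ii) for every $n$ and every definable type $p$ in $K^n$, $\ulcorner p\urcorner$ is interdefinable with some (possibly infinite) tuple of elements of sorts in $\mathcal{G}$; (iii) for every finite set $S$ of finite tuples of elements of sorts in $\mathcal{G}$, all of the same length and the same sorts, $\ulcorner S\urcorner$ is interdefinable with a finite tuple of elements of sorts in $\mathcal{G}$. Then $T$ eliminates imaginaries in the sorts $\mathcal{G}$: every element of $\mathbb{U}^{eq}$ is interdefinable with a finite tuple of elements of sorts in $\mathcal{G}$. -/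

import Mathlib

universe u v w

namespace ManySorted

/-! ### Many-sorted first-order logic -/

/-- A many-sorted first-order language: symbols carry the sorts of their arguments. -/
structure Language where
  Sorts : Type u
  Functions : {n : ℕ} → (Fin n → Sorts) → Sorts → Type u
  Relations : {n : ℕ} → (Fin n → Sorts) → Type u

/-- A many-sorted structure. Sorts may be empty. -/
structure Structure (L : Language.{u}) where
  carrier : L.Sorts → Type u
  funMap : {n : ℕ} → {τ : Fin n → L.Sorts} → {s : L.Sorts} →
    L.Functions τ s → (∀ i, carrier (τ i)) → carrier s
  relMap : {n : ℕ} → {τ : Fin n → L.Sorts} → L.Relations τ → (∀ i, carrier (τ i)) → Prop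

/-- Terms in the variables `V`, where the variable `v` has sort `σ v`. -/
inductive Term (L : Language.{u}) {V : Type v} (σ : V → L.Sorts) : L.Sorts → Type (max u v)
  | var (x : V) : Term L σ (σ x)
  | func {n : ℕ} {τ : Fin n → L.Sorts} {s : L.Sorts} (f : L.Functions τ s)
      (ts : ∀ i, Term L σ (τ i)) : Term L σ s

/-- First-order formulas whose free variables are the `v : V`, of sort `σ v`, together with a list
of variables of the sorts listed in `Γ` (the variables that will be quantified). -/
inductive BoundedFormula (L : Language.{u}) {V : Type v} (σ : V → L.Sorts) :
    List L.Sorts → Type (max u v)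
  | falsum {Γ : List L.Sorts} : BoundedFormula L σ Γ
  | equal {Γ : List L.Sorts} {s : L.Sorts} (t₁ t₂ : Term L (Sum.elim σ Γ.get) s) :
      BoundedFormula L σ Γ
  | rel {Γ : List L.Sorts} {n : ℕ} {τ : Fin n → L.Sorts} (R : L.Relations τ)
      (ts : ∀ i, Term L (Sum.elim σ Γ.get) (τ i)) : BoundedFormula L σ Γ
  | imp {Γ : List L.Sorts} (φ ψ : BoundedFormula L σ Γ) : BoundedFormula L σ Γ
  | all {Γ : List L.Sorts} {s : L.Sorts} (φ : BoundedFormula L σ (s :: Γ)) : BoundedFormula L σ Γ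

/-- First-order formulas in the free variables `v : V`, of sort `σ v`. -/
abbrev Formula (L : Language.{u}) {V : Type v} (σ : V → L.Sorts) : Type (max u v) :=
  BoundedFormula L σ []

abbrev Sentence (L : Language.{u}) : Type u := Formula L (Empty.elim : Empty → L.Sorts)

abbrev Theory (L : Language.{u}) : Type u := Set (Sentence L)

variable {L : Language.{u}}

namespace Structure

/-- The Cartesian product of the sorts `σ v` of `M`. -/
abbrev Tuple (M : Structure L) {V : Type v} (σ : V → L.Sorts) : Type (max u v) :=
  ∀ x, M.carrier (σ x)

end Structure

/-- Concatenation of two tuples. -/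
def join {M : Structure L} {V : Type v} {W : Type w} {σ : V → L.Sorts} {τ : W → L.Sorts}
    (a : M.Tuple σ) (b : M.Tuple τ) : M.Tuple (Sum.elim σ τ)
  | Sum.inl x => a x
  | Sum.inr y => b y

/-- Adding one element in front of a tuple. -/
def consTuple {M : Structure L} {s : L.Sorts} {Γ : List L.Sorts} (a : M.carrier s)
    (b : M.Tuple Γ.get) : M.Tuple (s :: Γ).get :=
  fun i => Fin.cases (motive := fun i => M.carrier ((s :: Γ).get i)) a b i

/-- The unique tuple of length zero. -/
def nilTuple {M : Structure L} : M.Tuple ([] : List L.Sorts).get := fun i => i.elim0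

def Term.realize {M : Structure L} {V : Type v} {σ : V → L.Sorts} (a : M.Tuple σ) :
    {s : L.Sorts} → Term L σ s → M.carrier s
  | _, .var x => a x
  | _, .func f ts => M.funMap f (fun i => (ts i).realize a)

def BoundedFormula.Realize {M : Structure L} {V : Type v} {σ : V → L.Sorts} (a : M.Tuple σ) :
    {Γ : List L.Sorts} → BoundedFormula L σ Γ → M.Tuple Γ.get → Prop
  | _, .falsum, _ => False
  | _, .equal t₁ t₂, b => t₁.realize (join a b) = t₂.realize (join a b)
  | _, .rel R ts, b => M.relMap R (fun i => (ts i).realize (join a b))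
  | _, .imp φ ψ, b => φ.Realize a b → ψ.Realize a b
  | _, .all φ, b => ∀ c, φ.Realize a (consTuple c b)

/-- `φ.Holds a` : the formula `φ` is true of the tuple `a` in `M`. -/
def Formula.Holds {M : Structure L} {V : Type v} {σ : V → L.Sorts} (φ : Formula L σ)
    (a : M.Tuple σ) : Prop :=
  BoundedFormula.Realize a φ nilTuple

namespace Structure

/-- `M` is a model of `T`. -/
def Models (M : Structure L) (T : Theory L) : Prop :=
  ∀ φ ∈ T, Formula.Holds (M := M) φ (fun x => x.elim)

/-! ### Monster models -/

/-- Automorphisms of a many-sorted structure. -/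
structure Automorphism (M : Structure L) where
  toEquiv : ∀ s, M.carrier s ≃ M.carrier s
  map_fun : ∀ {n : ℕ} {τ : Fin n → L.Sorts} {s : L.Sorts} (f : L.Functions τ s) (a : M.Tuple τ),
    toEquiv s (M.funMap f a) = M.funMap f (fun i => toEquiv (τ i) (a i))
  map_rel : ∀ {n : ℕ} {τ : Fin n → L.Sorts} (R : L.Relations τ) (a : M.Tuple τ),
    M.relMap R a ↔ M.relMap R (fun i => toEquiv (τ i) (a i))

/-- `κ`-saturation: a set `Φ` of formulas in finitely many variables, with parameters from a set
`A` of fewer than `κ` elements, that is finitely satisfiable in `M` is satisfied by a tuple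
of `M`. The parameter `a ∈ A` is substituted for the variable with index `a`. -/
def IsSaturated (M : Structure L) (κ : Cardinal.{u}) : Prop :=
  ∀ (A : Set (Σ s, M.carrier s)), Cardinal.mk A < κ →
    ∀ (n : ℕ) (σ : Fin n → L.Sorts) (Φ : Set (Formula L (Sum.elim σ (fun a : A => a.1.1)))),
      (∀ Φ₀ ⊆ Φ, Φ₀.Finite →
        ∃ x : M.Tuple σ, ∀ φ ∈ Φ₀, Formula.Holds φ (join x (fun a : A => a.1.2))) →
      ∃ x : M.Tuple σ, ∀ φ ∈ Φ, Formula.Holds φ (join x (fun a : A => a.1.2))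

/-- Strong `κ`-homogeneity: two tuples of length less than `κ` with the same type over `∅` are
conjugate under an automorphism. -/
def IsStronglyHomogeneous (M : Structure L) (κ : Cardinal.{u}) : Prop :=
  ∀ (I : Type u) (σ : I → L.Sorts) (a b : M.Tuple σ), Cardinal.mk I < κ →
    (∀ φ : Formula L σ, φ.Holds a ↔ φ.Holds b) →
    ∃ f : M.Automorphism, ∀ i, f.toEquiv (σ i) (a i) = b i

/-- `U` is a monster model of `T`: it is `κ`-saturated and strongly `κ`-homogeneous for some
uncountable cardinal `κ` larger than the number of sorts and symbols of the language. -/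
structure IsMonster (U : Structure L) (T : Theory L) : Prop where
  models : U.Models T
  exists_cardinal : ∃ κ : Cardinal.{u}, Cardinal.aleph0 < κ ∧
    Cardinal.mk L.Sorts < κ ∧
    Cardinal.mk (Σ (n : ℕ) (τ : Fin n → L.Sorts) (s : L.Sorts), L.Functions τ s) < κ ∧
    Cardinal.mk (Σ (n : ℕ) (τ : Fin n → L.Sorts), L.Relations τ) < κ ∧
    U.IsSaturated κ ∧ U.IsStronglyHomogeneous κ

/-! ### Imaginaries -/

/-- A sort of `U^eq`: a finite product of sorts of `U`, with a `∅`-definable equivalence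
relation on it. -/
structure EqSort (U : Structure L) where
  arity : ℕ
  sorts : Fin arity → L.Sorts
  rel : Setoid (U.Tuple sorts)
  definable : ∃ φ : Formula L (Sum.elim sorts sorts), ∀ a b, rel a b ↔ φ.Holds (join a b)

/-- The elements of the sort `S` of `U^eq`: the equivalence classes. -/
abbrev EqSort.Elem {U : Structure L} (S : U.EqSort) : Type u := Quotient S.rel

/-- The elements of `U^eq`. -/
abbrev Imaginary (U : Structure L) : Type u := Σ S : U.EqSort, S.Elem

/-- The tuples of elements of `U` that represent an imaginary. -/
def Imaginary.reps {U : Structure L} (e : U.Imaginary) : Set (U.Tuple e.1.sorts) :=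
  {a | (Quotient.mk e.1.rel a : e.1.Elem) = e.2}

/-- The sort `s` of `U`, as a sort of `U^eq`: the classes of equality on `s`. -/
def realSort (U : Structure L) (s : L.Sorts) : U.EqSort where
  arity := 1
  sorts := fun _ => s
  rel := ⊥
  definable := by
    refine ⟨.equal (.var (Sum.inl (Sum.inl 0))) (.var (Sum.inl (Sum.inr 0))), fun a b => ?_⟩
    change a = b ↔ a 0 = b 0
    constructor
    · rintro rfl
      rfl
    · intro h
      funext i
      rw [Fin.eq_zero i]
      exact h

/-- An element of `U` as an element of `U^eq`. -/
def real (U : Structure L) {s : L.Sorts} (a : U.carrier s) : U.Imaginary :=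
  ⟨U.realSort s, Quotient.mk (U.realSort s).rel (fun _ => a)⟩

/-- `X` is `A`-definable in `U^eq`, for a set `A` of imaginary parameters: it is defined by a
formula `φ(x, b₁, …, bₘ)` with `b₁, …, bₘ ∈ A`. Such a formula of `U^eq` is given by a formula of
`U` in which `bⱼ` is replaced by a representative, and whose truth value
does not depend on the choice of the representatives. -/
def DefinableOver (U : Structure L) (A : Set U.Imaginary) {V : Type v} {σ : V → L.Sorts}
    (X : Set (U.Tuple σ)) : Prop :=
  ∃ (m : ℕ) (b : Fin m → U.Imaginary), (∀ j, b j ∈ A) ∧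
    ∃ φ : Formula L (Sum.elim σ (fun p : Σ j, Fin (b j).1.arity => (b p.1).1.sorts p.2)),
      ∀ c : (∀ j, U.Tuple (b j).1.sorts), (∀ j, c j ∈ (b j).reps) →
        ∀ x, x ∈ X ↔ φ.Holds (join x (fun p => c p.1 p.2))

/-- For a set `X` of tuples of imaginaries of sorts `S v`, the set of the tuples of `U` that
represent an element of `X`. -/
def pullback {U : Structure L} {V : Type v} (S : V → U.EqSort) (X : Set (∀ x, (S x).Elem)) :
    Set (U.Tuple (fun p : Σ x, Fin (S x).arity => (S p.1).sorts p.2)) :=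
  {a | (fun x => (Quotient.mk (S x).rel (fun i => a ⟨x, i⟩) : (S x).Elem)) ∈ X}

/-- `dcl^eq(A)`: the imaginaries `e` for which `{e}` is `A`-definable. (A set of
imaginaries is `A`-definable if and only if the set of the representatives of its elements is.) -/
def dclEq (U : Structure L) (A : Set U.Imaginary) : Set U.Imaginary :=
  {e | U.DefinableOver A e.reps}

/-- `acl^eq(A)`: the imaginaries that belong to a finite `A`-definable set of
imaginaries. -/
def aclEq (U : Structure L) (A : Set U.Imaginary) : Set U.Imaginary :=
  {e | ∃ F : Set e.1.Elem, F.Finite ∧ e.2 ∈ F ∧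
    U.DefinableOver A {a : U.Tuple e.1.sorts | (Quotient.mk e.1.rel a : e.1.Elem) ∈ F}}

/-- Two sets (or possibly infinite tuples) of imaginaries are interdefinable. -/
def Interdefinable (U : Structure L) (A B : Set U.Imaginary) : Prop :=
  A ⊆ U.dclEq B ∧ B ⊆ U.dclEq A

/-- The codes `⌜X⌝` of a definable set `X`: the imaginaries `e` that are
canonical parameters of `X`, i.e. for some formula `φ(x, y)` without parameters, `X` is defined by
`φ(x, e)` and by no other `φ(x, y)` with `y` in the sort of `e`. All codes of `X` are
interdefinable. -/
def codes (U : Structure L) {V : Type v} {σ : V → L.Sorts} (X : Set (U.Tuple σ)) :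
    Set U.Imaginary :=
  {e | ∃ φ : Formula L (Sum.elim σ e.1.sorts),
    ∀ c, c ∈ e.reps ↔ ∀ x, x ∈ X ↔ φ.Holds (join x c)}

/-! ### Global types -/

/-- A global type: a complete type over `U` in variables of sorts `σ v`, given as the ultrafilter
of the definable sets (with parameters) that it contains. -/
structure GlobalType (U : Structure L) {V : Type v} (σ : V → L.Sorts) where
  sets : Set (Set (U.Tuple σ))
  definable : ∀ X ∈ sets, U.DefinableOver Set.univ X
  empty_notMem : ∅ ∉ sets
  inter_mem : ∀ X ∈ sets, ∀ Y ∈ sets, X ∩ Y ∈ sets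
  superset_mem : ∀ X ∈ sets, ∀ Y, U.DefinableOver Set.univ Y → X ⊆ Y → Y ∈ sets
  mem_or_compl_mem : ∀ X, U.DefinableOver Set.univ X → X ∈ sets ∨ Xᶜ ∈ sets

/-- The definition of `φ(x, y)` in the type `p`: the set of `b` with `φ(x, b) ∈ p`. -/
def GlobalType.defn {U : Structure L} {V : Type v} {σ : V → L.Sorts} (p : U.GlobalType σ) {m : ℕ}
    {τ : Fin m → L.Sorts} (φ : Formula L (Sum.elim σ τ)) : Set (U.Tuple τ) :=
  {b | {x | φ.Holds (join x b)} ∈ p.sets}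

/-- The type `p` is `A`-definable. -/
def GlobalType.IsDefinableOver {U : Structure L} {V : Type v} {σ : V → L.Sorts}
    (p : U.GlobalType σ) (A : Set U.Imaginary) : Prop :=
  ∀ (m : ℕ) (τ : Fin m → L.Sorts) (φ : Formula L (Sum.elim σ τ)), U.DefinableOver A (p.defn φ)

/-- `⌜p⌝`: the set of codes of the definitions of `p`. -/
def GlobalType.codes {U : Structure L} {V : Type v} {σ : V → L.Sorts} (p : U.GlobalType σ) :
    Set U.Imaginary :=
  {e | ∃ (m : ℕ) (τ : Fin m → L.Sorts) (φ : Formula L (Sum.elim σ τ)), e ∈ U.codes (p.defn φ)}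

/-! ### Home sorts, coding and elimination of imaginaries -/

/-- `K` is a home sort: `U^eq = dcl^eq(K)`. -/
def IsHomeSort (U : Structure L) (K : L.Sorts) : Prop :=
  U.dclEq (Set.range (fun a : U.carrier K => U.real a)) = Set.univ

/-- The set `A` of imaginaries is interdefinable with a finite tuple of elements of
sorts in `G`. -/
def HasFiniteCodeIn (U : Structure L) (A : Set U.Imaginary) (G : Set U.EqSort) : Prop :=
  ∃ (k : ℕ) (t : Fin k → U.Imaginary), (∀ j, (t j).1 ∈ G) ∧ U.Interdefinable A (Set.range t)

/-- The set `A` of imaginaries is interdefinable with a possibly infinite tuple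
of elements of sorts in `G`. -/
def HasCodeIn (U : Structure L) (A : Set U.Imaginary) (G : Set U.EqSort) : Prop :=
  ∃ B : Set U.Imaginary, (∀ t ∈ B, t.1 ∈ G) ∧ U.Interdefinable A B

/-- Elimination of imaginaries in the sorts `G`: every imaginary is interdefinable with a finite
tuple of elements of sorts in `G`. -/
def EliminatesImaginariesIn (U : Structure L) (G : Set U.EqSort) : Prop :=
  ∀ e : U.Imaginary, U.HasFiniteCodeIn {e} G

end Structure

end ManySorted

/-! Let `e` be an imaginary. Since `K` is a home sort, `e` is definable from some tuple of `Kⁿ` by a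
formula `R`, so the set `Y` of all tuples from which `R` defines `e` is non-empty and `e`-definable.
If `Y` contains a type `p` definable over `acl^eq(e)`, then `e` lies in `⌜p⌝`, because almost every
realization defines `e` in the same way, while `⌜p⌝` lies in `acl^eq(e)`. Coding `p` in `G` and
keeping only the finitely many elements needed to define `e` gives a finite tuple `t` of
`G`-elements, algebraic over `e`, with `e` in `dcl^eq(t)`. A finite `e`-definable set of tuples that
contains `t`, and each of which defines `e` in the same way, is interdefinable with `e`, and
hypothesis (iii) codes it in `G` (`exists_interdefinable_finite`).

The main work is to pass from subsets of `K` to subsets of `Kⁿ` (`exists_definable_type_succ`).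
Given an `A`-definable `X` in `Kⁿ⁺¹`, choose a definable type `p` in its first projection, a
realization `y₀` of `p` over suitable parameters, and a definable type `q` in the fibre over `y₀`.
The type `q` is definable only over the algebraic closure of `y₀` and parameters from `A`, so its
transport to other realizations `y` involves a choice of conjugate. Arbitrary automorphisms make the
choice, and an ultrafilter extending `p` integrates the resulting types.

Definability survives these choices because a set is `acl^eq(A)`-definable exactly when it is
invariant under an `A`-definable equivalence relation with finitely many classes
(`exists_isFiniteEquivalence_of_aclEq`, `isDefinableOver_aclEq_of_invariant`). Each definition of
`q` has such a relation over `y₀`; the generic value of these relations along `p` is again a finite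
equivalence relation, now over `acl^eq(A)`, and an `A`-definable refinement of it preserves the
corresponding definition of the integral. -/

namespace ManySorted

open Structure

variable {L : Language.{u}}

/-! ### Substitution and automorphisms -/

/-- Substitution of terms for the variables of a term. -/
def Term.subst {V : Type v} {W : Type w} {σ : V → L.Sorts} {τ : W → L.Sorts}
    (f : ∀ x, Term L τ (σ x)) : {s : L.Sorts} → Term L σ s → Term L τ s
  | _, .var x => f x
  | _, .func g ts => .func g (fun i => (ts i).subst f)

theorem Term.realize_subst {M : Structure L} {V : Type v} {W : Type w} {σ : V → L.Sorts}
    {τ : W → L.Sorts} (f : ∀ x, Term L τ (σ x)) (a : M.Tuple σ) (b : M.Tuple τ)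
    (h : ∀ x, (f x).realize b = a x) {s : L.Sorts} (t : Term L σ s) :
    (t.subst f).realize b = t.realize a := by
  induction t with
  | var x => exact h x
  | func g ts ih => simp only [Term.subst, Term.realize, ih]

/-- The variables of a context, after a bound variable has been added. -/
def weakenVar {W : Type w} {τ : W → L.Sorts} {Δ : List L.Sorts} (s : L.Sorts) :
    ∀ y, Term L (Sum.elim τ (s :: Δ).get) (Sum.elim τ Δ.get y)
  | Sum.inl y => .var (σ := Sum.elim τ (s :: Δ).get) (Sum.inl y)
  | Sum.inr j => .var (σ := Sum.elim τ (s :: Δ).get) (Sum.inr j.succ)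

theorem realize_weakenVar {M : Structure L} {W : Type w} {τ : W → L.Sorts} {Δ : List L.Sorts}
    (s : L.Sorts) (a : M.Tuple τ) (b : M.Tuple Δ.get) (c : M.carrier s) (y) :
    (weakenVar s y).realize (join a (consTuple c b)) = join a b y := by
  cases y <;> rfl

/-- Lifting of a substitution under a quantifier. -/
def liftSubst {V : Type v} {W : Type w} {σ : V → L.Sorts} {τ : W → L.Sorts}
    {Γ Δ : List L.Sorts} (s : L.Sorts)
    (f : ∀ x, Term L (Sum.elim τ Δ.get) (Sum.elim σ Γ.get x)) :
    ∀ x, Term L (Sum.elim τ (s :: Δ).get) (Sum.elim σ (s :: Γ).get x)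
  | Sum.inl x => (f (Sum.inl x)).subst (weakenVar s)
  | Sum.inr ⟨0, _⟩ =>
    .var (σ := Sum.elim τ (s :: Δ).get) (Sum.inr (⟨0, Nat.succ_pos _⟩ : Fin (Δ.length + 1)))
  | Sum.inr ⟨i + 1, h⟩ => (f (Sum.inr ⟨i, Nat.lt_of_succ_lt_succ h⟩)).subst (weakenVar s)

theorem realize_liftSubst {M : Structure L} {V : Type v} {W : Type w} {σ : V → L.Sorts}
    {τ : W → L.Sorts} {Γ Δ : List L.Sorts} (s : L.Sorts)
    (f : ∀ x, Term L (Sum.elim τ Δ.get) (Sum.elim σ Γ.get x))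
    (a : M.Tuple σ) (b : M.Tuple Γ.get) (a' : M.Tuple τ) (b' : M.Tuple Δ.get)
    (h : ∀ x, (f x).realize (join a' b') = join a b x) (c : M.carrier s) (x) :
    (liftSubst s f x).realize (join a' (consTuple c b')) = join a (consTuple c b) x := by
  match x with
  | Sum.inl x =>
    exact (Term.realize_subst _ _ _ (realize_weakenVar s a' b' c) _).trans (h (Sum.inl x))
  | Sum.inr ⟨0, _⟩ => rfl
  | Sum.inr ⟨i + 1, hi⟩ =>
    exact (Term.realize_subst _ _ _ (realize_weakenVar s a' b' c) _).trans
      (h (Sum.inr ⟨i, Nat.lt_of_succ_lt_succ hi⟩))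

/-- Substitution of terms for the variables of a formula. -/
def BoundedFormula.subst {V : Type v} {W : Type w} {σ : V → L.Sorts} {τ : W → L.Sorts} :
    {Γ : List L.Sorts} → BoundedFormula L σ Γ → {Δ : List L.Sorts} →
    (∀ x, Term L (Sum.elim τ Δ.get) (Sum.elim σ Γ.get x)) → BoundedFormula L τ Δ
  | _, .falsum, _, _ => .falsum
  | _, .equal t₁ t₂, _, f => .equal (t₁.subst f) (t₂.subst f)
  | _, .rel R ts, _, f => .rel R (fun i => (ts i).subst f)
  | _, .imp φ ψ, _, f => .imp (φ.subst f) (ψ.subst f)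
  | _, .all (s := s) φ, _, f => .all (φ.subst (liftSubst s f))

theorem BoundedFormula.realize_subst {M : Structure L} {V : Type v} {W : Type w}
    {σ : V → L.Sorts} {τ : W → L.Sorts} {Γ : List L.Sorts} (φ : BoundedFormula L σ Γ)
    {Δ : List L.Sorts} (f : ∀ x, Term L (Sum.elim τ Δ.get) (Sum.elim σ Γ.get x))
    (a : M.Tuple σ) (b : M.Tuple Γ.get) (a' : M.Tuple τ) (b' : M.Tuple Δ.get)
    (h : ∀ x, (f x).realize (join a' b') = join a b x) :
    (φ.subst f).Realize a' b' ↔ φ.Realize a b := by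
  induction φ generalizing Δ with
  | falsum => rfl
  | equal t₁ t₂ =>
    simp only [BoundedFormula.subst, BoundedFormula.Realize, Term.realize_subst f _ _ h]
  | rel R ts =>
    simp only [BoundedFormula.subst, BoundedFormula.Realize, Term.realize_subst f _ _ h]
  | imp φ ψ ih₁ ih₂ =>
    simp only [BoundedFormula.subst, BoundedFormula.Realize, ih₁ f b b' h, ih₂ f b b' h]
  | all φ ih =>
    exact forall_congr' fun c => ih _ _ _ (realize_liftSubst _ f a b a' b' h c)

namespace Structure

variable {U : Structure L}

/-- The action of an automorphism on tuples. -/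
def Automorphism.map (f : U.Automorphism) {V : Type v} {σ : V → L.Sorts} (a : U.Tuple σ) :
    U.Tuple σ := fun x => f.toEquiv (σ x) (a x)

theorem Automorphism.realize_term (f : U.Automorphism) {V : Type v} {σ : V → L.Sorts}
    (a : U.Tuple σ) {s : L.Sorts} (t : Term L σ s) :
    t.realize (f.map a) = f.toEquiv s (t.realize a) := by
  induction t with
  | var x => rfl
  | func g ts ih => simp only [Term.realize, ih, f.map_fun]

theorem Automorphism.map_join (f : U.Automorphism) {V : Type v} {W : Type w} {σ : V → L.Sorts}
    {τ : W → L.Sorts} (a : U.Tuple σ) (b : U.Tuple τ) :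
    f.map (join a b) = join (f.map a) (f.map b) := by
  funext x
  cases x <;> rfl

theorem Automorphism.realize_iff (f : U.Automorphism) {V : Type v} {σ : V → L.Sorts}
    (a : U.Tuple σ) {Γ : List L.Sorts} (φ : BoundedFormula L σ Γ) (b : U.Tuple Γ.get) :
    φ.Realize (f.map a) (f.map b) ↔ φ.Realize a b := by
  induction φ with
  | falsum => rfl
  | equal t₁ t₂ =>
    simp only [BoundedFormula.Realize, ← f.map_join, f.realize_term, (f.toEquiv _).apply_eq_iff_eq]
  | rel R ts =>
    simp only [BoundedFormula.Realize, ← f.map_join, f.realize_term, ← f.map_rel]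
  | imp φ ψ ih₁ ih₂ => simp only [BoundedFormula.Realize, ih₁, ih₂]
  | all φ ih =>
    refine ((f.toEquiv _).forall_congr fun c => ?_).symm
    rw [← ih]
    refine iff_of_eq (congrArg _ ?_)
    funext i
    refine Fin.cases ?_ (fun j => ?_) i <;> rfl

theorem Automorphism.holds_iff (f : U.Automorphism) {V : Type v} {σ : V → L.Sorts}
    (a : U.Tuple σ) (φ : Formula L σ) : φ.Holds (f.map a) ↔ φ.Holds a := by
  rw [Formula.Holds, Formula.Holds, ← f.realize_iff a]
  refine iff_of_eq (congrArg _ ?_)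
  funext i
  exact i.elim0

/-! ### Definable predicates -/

/-- The predicate `P` is defined by a formula without parameters. -/
def IsDefinable (U : Structure L) {V : Type v} (σ : V → L.Sorts) (P : U.Tuple σ → Prop) : Prop :=
  ∃ φ : Formula L σ, ∀ a, P a ↔ φ.Holds a

/-- The coordinates of `f` are given by terms. -/
def IsTermMap {V : Type v} {W : Type w} {σ : V → L.Sorts} {τ : W → L.Sorts}
    (f : U.Tuple σ → U.Tuple τ) : Prop :=
  ∀ y, ∃ t : Term L σ (τ y), ∀ a, f a y = t.realize a

section TermMap

variable {V : Type*} {W : Type*} {W' : Type*} {σ : V → L.Sorts} {τ : W → L.Sorts}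
  {τ' : W' → L.Sorts}

theorem IsTermMap.id : IsTermMap (fun a : U.Tuple σ => a) := fun y => ⟨.var y, fun _ => rfl⟩

theorem IsTermMap.comp {g : U.Tuple τ → U.Tuple τ'} (hg : IsTermMap g)
    {f : U.Tuple σ → U.Tuple τ} (hf : IsTermMap f) : IsTermMap (fun a => g (f a)) := by
  intro y
  obtain ⟨t, ht⟩ := hg y
  choose t' ht' using hf
  exact ⟨t.subst t', fun a => (ht (f a)).trans
    (Term.realize_subst t' (f a) a (fun x => (ht' x a).symm) t).symm⟩

theorem IsTermMap.proj (ρ : W → V) :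
    IsTermMap (U := U) (σ := σ) (τ := fun y => σ (ρ y)) (fun a y => a (ρ y)) :=
  fun y => ⟨.var (ρ y), fun _ => rfl⟩

theorem IsTermMap.inl : IsTermMap (U := U) (σ := Sum.elim σ τ) (τ := σ)
    (fun a y => a (Sum.inl y)) :=
  fun y => ⟨.var (σ := Sum.elim σ τ) (Sum.inl y), fun _ => rfl⟩

theorem IsTermMap.inr : IsTermMap (U := U) (σ := Sum.elim σ τ) (τ := τ)
    (fun a y => a (Sum.inr y)) :=
  fun y => ⟨.var (σ := Sum.elim σ τ) (Sum.inr y), fun _ => rfl⟩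

theorem IsTermMap.join {f : U.Tuple σ → U.Tuple τ} {g : U.Tuple σ → U.Tuple τ'}
    (hf : IsTermMap f) (hg : IsTermMap g) :
    IsTermMap (τ := Sum.elim τ τ') (fun a => ManySorted.join (f a) (g a))
  | Sum.inl y => hf y
  | Sum.inr y => hg y

/-- A bijection between index sets reindexes tuples. -/
theorem exists_reindex (e : V ≃ W) (σ : V → L.Sorts) :
    ∃ τ : W → L.Sorts, ∃ h : U.Tuple τ ≃ U.Tuple σ, IsTermMap h ∧ IsTermMap h.symm := by
  -- Writing the old sorts as a composite with `e` makes the sorts agree definitionally, so no casts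
  -- between carriers occur.
  obtain ⟨τ, rfl⟩ : ∃ τ : W → L.Sorts, σ = fun x => τ (e x) :=
    ⟨fun y => σ (e.symm y), by simp⟩
  refine ⟨τ, (Equiv.piCongrLeft (fun y => U.carrier (τ y)) e).symm, fun x => ⟨.var (e x), ?_⟩,
    fun y => ?_⟩
  · intro a
    rfl
  · obtain ⟨x, rfl⟩ := e.surjective y
    refine ⟨.var (σ := fun x => τ (e x)) x, fun a => ?_⟩
    exact Equiv.piCongrLeft_apply_apply (fun y => U.carrier (τ y)) e a x

end TermMap

section Definable

variable {V : Type*} {W : Type*} {σ : V → L.Sorts} {τ : W → L.Sorts}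
  {P Q : U.Tuple σ → Prop}

theorem IsDefinable.congr (h : IsDefinable U σ P) (hPQ : ∀ a, Q a ↔ P a) : IsDefinable U σ Q := by
  rwa [show Q = P from funext fun a => propext (hPQ a)]

theorem IsDefinable.false : IsDefinable U σ fun _ => False := ⟨.falsum, fun _ => Iff.rfl⟩

theorem IsDefinable.imp (hP : IsDefinable U σ P) (hQ : IsDefinable U σ Q) :
    IsDefinable U σ fun a => P a → Q a := by
  obtain ⟨φ, hφ⟩ := hP
  obtain ⟨ψ, hψ⟩ := hQ
  exact ⟨.imp φ ψ, fun a => imp_congr (hφ a) (hψ a)⟩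

theorem IsDefinable.not (hP : IsDefinable U σ P) : IsDefinable U σ fun a => ¬ P a :=
  hP.imp .false

theorem IsDefinable.true : IsDefinable U σ fun _ => True :=
  (IsDefinable.false.imp .false).congr (by simp)

theorem IsDefinable.and (hP : IsDefinable U σ P) (hQ : IsDefinable U σ Q) :
    IsDefinable U σ fun a => P a ∧ Q a :=
  (hP.imp hQ.not).not.congr (by simp)

theorem IsDefinable.iff (hP : IsDefinable U σ P) (hQ : IsDefinable U σ Q) :
    IsDefinable U σ fun a => P a ↔ Q a :=
  ((hP.imp hQ).and (hQ.imp hP)).congr (fun _ => iff_def)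

/-- Definability is treated semantically from here on. Closure under term maps covers every
renaming, duplication and permutation of variables, so formulas need not be written out. -/
theorem IsDefinable.comp (hP : IsDefinable U σ P) {f : U.Tuple τ → U.Tuple σ} (hf : IsTermMap f) :
    IsDefinable U τ fun a => P (f a) := by
  obtain ⟨φ, hφ⟩ := hP
  choose t ht using hf
  refine ⟨φ.subst (Δ := []) (fun x => match x with
    | Sum.inl x => (t x).subst fun y => .var (σ := Sum.elim τ ([] : List L.Sorts).get) (Sum.inl y)
    | Sum.inr i => i.elim0), fun a => ?_⟩
  refine (hφ (f a)).trans (BoundedFormula.realize_subst φ _ (f a) nilTuple a nilTuple ?_).symm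
  rintro (x | i)
  · exact (Term.realize_subst _ a _ (fun _ => rfl) _).trans (ht x a).symm
  · exact i.elim0

theorem IsDefinable.eq {s : L.Sorts} (t₁ t₂ : Term L σ s) :
    IsDefinable U σ fun a => t₁.realize a = t₂.realize a := by
  let f : ∀ x, Term L (Sum.elim σ ([] : List L.Sorts).get) (σ x) := fun x =>
    .var (σ := Sum.elim σ ([] : List L.Sorts).get) (Sum.inl x)
  refine ⟨.equal (t₁.subst f) (t₂.subst f), fun a => ?_⟩
  have h : ∀ t : Term L σ s, (t.subst f).realize (join a nilTuple) = t.realize a := fun t =>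
    Term.realize_subst f a _ (fun _ => rfl) t
  exact iff_of_eq (congrArg₂ (· = ·) (h t₁).symm (h t₂).symm)

theorem IsDefinable.all_single {s : L.Sorts} {R : U.Tuple σ → U.carrier s → Prop}
    (hR : IsDefinable U (Sum.elim σ fun _ : Unit => s)
      fun a => R (fun x => a (Sum.inl x)) (a (Sum.inr ()))) :
    IsDefinable U σ fun a => ∀ c, R a c := by
  obtain ⟨φ, hφ⟩ := hR
  refine ⟨.all (s := s) (φ.subst (Δ := [s]) (fun x => match x with
    | Sum.inl (Sum.inl x) => .var (σ := Sum.elim σ [s].get) (Sum.inl x)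
    | Sum.inl (Sum.inr _) => .var (σ := Sum.elim σ [s].get) (Sum.inr (0 : Fin 1))
    | Sum.inr i => i.elim0)), fun a => forall_congr' fun c => ?_⟩
  refine (hφ (ManySorted.join a fun _ => c)).trans ?_
  refine (BoundedFormula.realize_subst φ _ _ nilTuple a _ ?_).symm
  rintro ((x | x) | i)
  · rfl
  · rfl
  · exact i.elim0

theorem IsDefinable.all_fin {n : ℕ} {τ : Fin n → L.Sorts} {R : U.Tuple σ → U.Tuple τ → Prop}
    (hR : IsDefinable U (Sum.elim σ τ)
      fun a => R (fun x => a (Sum.inl x)) (fun y => a (Sum.inr y))) :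
    IsDefinable U σ fun a => ∀ b, R a b := by
  -- The first quantified coordinate joins the free variables, so their index type must vary in the
  -- induction.
  induction n generalizing V with
  | zero =>
    refine (hR.comp (f := fun a => ManySorted.join a fun i => i.elim0)
      (IsTermMap.id.join fun i => i.elim0)).congr fun a => ?_
    exact ⟨fun h => h _, fun h b => (congrArg (R a) (funext fun i => i.elim0)).mpr h⟩
  | succ n ih =>
    have h : IsDefinable U σ fun a => ∀ (c : U.carrier (τ 0)) (b : U.Tuple fun i : Fin n => τ i.succ),
        R a (Fin.cons (α := fun i => U.carrier (τ i)) c b) := by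
      refine IsDefinable.all_single (ih ?_)
      refine hR.comp (f := fun a : U.Tuple (Sum.elim (Sum.elim σ fun _ : Unit => τ 0) fun i : Fin n => τ i.succ) =>
        ManySorted.join (fun x => a (Sum.inl (Sum.inl x)))
        (Fin.cons (α := fun i => U.carrier (τ i)) (a (Sum.inl (Sum.inr ())))
          fun i => a (Sum.inr i))) ?_
      refine IsTermMap.join (IsTermMap.inl.comp IsTermMap.inl) fun i => ?_
      refine Fin.cases ?_ (fun i => ?_) i
      · exact ⟨.var (σ := Sum.elim (Sum.elim σ fun _ : Unit => τ 0) fun i : Fin n => τ i.succ)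
          (Sum.inl (Sum.inr ())), fun _ => rfl⟩
      · exact ⟨.var (σ := Sum.elim (Sum.elim σ fun _ : Unit => τ 0) fun i : Fin n => τ i.succ)
          (Sum.inr i), fun _ => rfl⟩
    refine h.congr fun a => ⟨fun h c b => h _, fun h b => ?_⟩
    rw [← Fin.cons_self_tail b]
    exact h _ _

theorem IsDefinable.all [Finite W] {R : U.Tuple σ → U.Tuple τ → Prop}
    (hR : IsDefinable U (Sum.elim σ τ)
      fun a => R (fun x => a (Sum.inl x)) (fun y => a (Sum.inr y))) :
    IsDefinable U σ fun a => ∀ b, R a b := by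
  obtain ⟨n, ⟨e⟩⟩ := Finite.exists_equiv_fin W
  obtain ⟨τ', h, hh, -⟩ := exists_reindex (U := U) e τ
  have : IsDefinable U σ fun a => ∀ b : U.Tuple τ', R a (h b) :=
    IsDefinable.all_fin (hR.comp (f := fun a : U.Tuple (Sum.elim σ τ') => ManySorted.join (fun x => a (Sum.inl x))
      (h fun y => a (Sum.inr y))) (IsTermMap.inl.join (hh.comp IsTermMap.inr)))
  exact this.congr fun a => h.forall_congr_right.symm

theorem IsDefinable.ex [Finite W] {R : U.Tuple σ → U.Tuple τ → Prop}
    (hR : IsDefinable U (Sum.elim σ τ)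
      fun a => R (fun x => a (Sum.inl x)) (fun y => a (Sum.inr y))) :
    IsDefinable U σ fun a => ∃ b, R a b :=
  (IsDefinable.all (R := fun a b => ¬ R a b) hR.not).not.congr fun a => by simp

theorem IsDefinable.forall_finite {ι : Type*} [Finite ι] {R : ι → U.Tuple σ → Prop}
    (hR : ∀ i, IsDefinable U σ (R i)) : IsDefinable U σ fun a => ∀ i, R i a := by
  have : ∀ s : Finset ι, IsDefinable U σ fun a => ∀ i ∈ s, R i a := by
    classical
    intro s
    induction s using Finset.induction_on with
    | empty => exact IsDefinable.true.congr (by simp)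
    | insert i s _ ih => exact ((hR i).and ih).congr (by simp)
  cases nonempty_fintype ι
  exact (this Finset.univ).congr (by simp)

theorem isDefinable_rel (S : U.EqSort) :
    IsDefinable U (Sum.elim S.sorts S.sorts)
      fun a => S.rel (fun i => a (Sum.inl i)) (fun i => a (Sum.inr i)) := by
  obtain ⟨φ, hφ⟩ := S.definable
  refine ⟨φ, fun a => (hφ _ _).trans (iff_of_eq (congrArg _ ?_))⟩
  funext x
  cases x <;> rfl

theorem IsDefinable.rel {S : U.EqSort} {f g : U.Tuple σ → U.Tuple S.sorts} (hf : IsTermMap f)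
    (hg : IsTermMap g) : IsDefinable U σ fun a => S.rel (f a) (g a) :=
  (isDefinable_rel S).comp (f := fun a => ManySorted.join (f a) (g a)) (hf.join hg)

theorem IsDefinable.eq_tuple [Finite W] {f g : U.Tuple σ → U.Tuple τ} (hf : IsTermMap f)
    (hg : IsTermMap g) : IsDefinable U σ fun a => f a = g a := by
  choose t ht using hf
  choose t' ht' using hg
  refine (IsDefinable.forall_finite fun y => IsDefinable.eq (t y) (t' y)).congr fun a => ?_
  simp only [← ht, ← ht', funext_iff]

theorem IsDefinable.map_automorphism (hP : IsDefinable U σ P) (f : U.Automorphism)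
    (a : U.Tuple σ) : P (f.map a) ↔ P a := by
  obtain ⟨φ, hφ⟩ := hP
  rw [hφ, hφ, f.holds_iff]

end Definable

/-! ### Predicates definable over imaginary parameters -/

/-- The first part of a concatenated tuple. -/
abbrev lft {V : Type v} {W : Type w} {σ : V → L.Sorts} {τ : W → L.Sorts}
    (a : U.Tuple (Sum.elim σ τ)) : U.Tuple σ := fun x => a (Sum.inl x)

/-- The second part of a concatenated tuple. -/
abbrev rgt {V : Type v} {W : Type w} {σ : V → L.Sorts} {τ : W → L.Sorts}
    (a : U.Tuple (Sum.elim σ τ)) : U.Tuple τ := fun x => a (Sum.inr x)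

theorem join_lft_rgt {V : Type v} {W : Type w} {σ : V → L.Sorts} {τ : W → L.Sorts}
    (a : U.Tuple (Sum.elim σ τ)) : join (lft a) (rgt a) = a := by
  funext x
  cases x <;> rfl

/-- The sorts of the representatives of a family of imaginaries. -/
abbrev repSorts {J : Type v} (b : J → U.Imaginary) : (Σ j, Fin (b j).1.arity) → L.Sorts :=
  fun p => (b p.1).1.sorts p.2

/-- `c` represents the family `b` of imaginaries. -/
def IsRep {J : Type v} (b : J → U.Imaginary) (c : U.Tuple (repSorts b)) : Prop :=
  ∀ j, (fun i => c ⟨j, i⟩) ∈ (b j).reps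

theorem Imaginary.exists_mem_reps (e : U.Imaginary) : ∃ a, a ∈ e.reps := Quotient.exists_rep e.2

theorem exists_isRep {J : Type v} (b : J → U.Imaginary) : ∃ c, IsRep b c := by
  choose c hc using fun j => (b j).exists_mem_reps
  exact ⟨fun p => c p.1 p.2, hc⟩

theorem Imaginary.mem_reps_iff {e : U.Imaginary} {c : U.Tuple e.1.sorts} (hc : c ∈ e.reps)
    (a : U.Tuple e.1.sorts) : a ∈ e.reps ↔ e.1.rel a c := by
  change (Quotient.mk e.1.rel a : e.1.Elem) = e.2 ↔ _
  rw [← show (Quotient.mk e.1.rel c : e.1.Elem) = e.2 from hc]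
  exact Quotient.eq

/-- The predicate `P` is `A`-definable in `U^eq`. -/
def IsDefinableOver (U : Structure L) (A : Set U.Imaginary) {V : Type v} (σ : V → L.Sorts)
    (P : U.Tuple σ → Prop) : Prop :=
  U.DefinableOver A {x | P x}

section IsDefinableOver

variable {A B : Set U.Imaginary} {V : Type*} {W : Type*} {σ : V → L.Sorts} {τ : W → L.Sorts}
  {P Q : U.Tuple σ → Prop}

/-- Arbitrary finite index types allow parameter lists to be merged as `J ⊕ J'`, and a definable
relation in place of a formula gives access to the closure properties of `IsDefinable`. -/
theorem isDefinableOver_iff : IsDefinableOver U A σ P ↔ ∃ (J : Type) (_ : Finite J)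
    (b : J → U.Imaginary), (∀ j, b j ∈ A) ∧ ∃ R : U.Tuple σ → U.Tuple (repSorts b) → Prop,
      IsDefinable U (Sum.elim σ (repSorts b)) (fun a => R (lft a) (rgt a)) ∧
      ∀ c, IsRep b c → ∀ x, P x ↔ R x c := by
  constructor
  · rintro ⟨m, b, hb, φ, hφ⟩
    refine ⟨Fin m, inferInstance, b, hb, fun x c => φ.Holds (join x c), ⟨φ, fun a => ?_⟩,
      fun c hc x => ?_⟩
    · exact iff_of_eq (congrArg φ.Holds (join_lft_rgt a))
    · exact hφ (fun j i => c ⟨j, i⟩) hc x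
  · rintro ⟨J, _, b, hb, R, hR, h⟩
    obtain ⟨m, ⟨e⟩⟩ := Finite.exists_equiv_fin J
    obtain ⟨b, rfl⟩ : ∃ b' : Fin m → U.Imaginary, b = fun j => b' (e j) :=
      ⟨fun j => b (e.symm j), by simp⟩
    have hR' : IsDefinable U (Sum.elim σ (repSorts b))
        fun a => R (lft a) (fun p => rgt a ⟨e p.1, p.2⟩) :=
      hR.comp (f := fun a : U.Tuple (Sum.elim σ (repSorts b)) =>
          join (lft a) fun p : Σ j, Fin (b (e j)).1.arity => rgt a ⟨e p.1, p.2⟩)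
        (IsTermMap.inl.join (IsTermMap.proj (σ := Sum.elim σ (repSorts b))
          fun p : Σ j, Fin (b (e j)).1.arity => Sum.inr (⟨e p.1, p.2⟩ : Σ j, Fin (b j).1.arity)))
    obtain ⟨φ, hφ⟩ := hR'
    refine ⟨m, b, fun j => by simpa using hb (e.symm j), φ, fun c hc x => ?_⟩
    exact (h (fun p => c (e p.1) p.2) (fun j => hc (e j)) x).trans
      (hφ (join x fun p : Σ j, Fin (b j).1.arity => c p.1 p.2))

theorem IsDefinableOver.congr (h : IsDefinableOver U A σ P) (hPQ : ∀ a, Q a ↔ P a) :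
    IsDefinableOver U A σ Q := by
  rwa [show Q = P from funext fun a => propext (hPQ a)]

theorem IsDefinableOver.mono (h : IsDefinableOver U A σ P) (hAB : A ⊆ B) :
    IsDefinableOver U B σ P := by
  obtain ⟨m, b, hb, φ, hφ⟩ := h
  exact ⟨m, b, fun j => hAB (hb j), φ, hφ⟩

theorem IsDefinable.over (h : IsDefinable U σ P) : IsDefinableOver U A σ P :=
  isDefinableOver_iff.mpr ⟨Empty, inferInstance, Empty.elim, fun j => j.elim, fun x _ => P x,
    h.comp IsTermMap.inl, fun _ _ _ => Iff.rfl⟩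

theorem isDefinableOver_reps {e : U.Imaginary} (he : e ∈ A) :
    IsDefinableOver U A e.1.sorts (· ∈ e.reps) :=
  isDefinableOver_iff.mpr ⟨Unit, inferInstance, fun _ => e, fun _ => he,
    fun x c => e.1.rel x fun i => c ⟨(), i⟩,
    IsDefinable.rel IsTermMap.inl (IsTermMap.comp (IsTermMap.proj (σ := repSorts fun _ : Unit => e)
      fun i => ⟨(), i⟩) IsTermMap.inr),
    fun _ hc x => Imaginary.mem_reps_iff (hc ()) x⟩

theorem IsDefinableOver.imp (hP : IsDefinableOver U A σ P) (hQ : IsDefinableOver U A σ Q) :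
    IsDefinableOver U A σ fun a => P a → Q a := by
  obtain ⟨J, _, b, hb, R, hR, h⟩ := isDefinableOver_iff.mp hP
  obtain ⟨J', _, b', hb', R', hR', h'⟩ := isDefinableOver_iff.mp hQ
  let d : J ⊕ J' → U.Imaginary := Sum.elim b b'
  refine isDefinableOver_iff.mpr ⟨J ⊕ J', inferInstance, d, ?_,
    fun x c => R x (fun p => c ⟨Sum.inl p.1, p.2⟩) → R' x (fun p => c ⟨Sum.inr p.1, p.2⟩),
    IsDefinable.imp ?_ ?_, fun c hc x =>
      imp_congr (h (fun p => c ⟨Sum.inl p.1, p.2⟩) (fun j => hc (Sum.inl j)) x)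
        (h' (fun p => c ⟨Sum.inr p.1, p.2⟩) (fun j => hc (Sum.inr j)) x)⟩
  · rintro (j | j)
    exacts [hb j, hb' j]
  · exact hR.comp (f := fun a : U.Tuple (Sum.elim σ (repSorts d)) =>
      join (lft a) fun p => rgt a ⟨Sum.inl p.1, p.2⟩) (IsTermMap.inl.join
        ((IsTermMap.proj (σ := repSorts d) fun p : Σ j, Fin (b j).1.arity =>
          ⟨Sum.inl p.1, p.2⟩).comp IsTermMap.inr))
  · exact hR'.comp (f := fun a : U.Tuple (Sum.elim σ (repSorts d)) =>
      join (lft a) fun p => rgt a ⟨Sum.inr p.1, p.2⟩) (IsTermMap.inl.join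
        ((IsTermMap.proj (σ := repSorts d) fun p : Σ j, Fin (b' j).1.arity =>
          ⟨Sum.inr p.1, p.2⟩).comp IsTermMap.inr))

theorem IsDefinableOver.not (hP : IsDefinableOver U A σ P) :
    IsDefinableOver U A σ fun a => ¬ P a :=
  hP.imp IsDefinable.false.over

theorem IsDefinableOver.and (hP : IsDefinableOver U A σ P) (hQ : IsDefinableOver U A σ Q) :
    IsDefinableOver U A σ fun a => P a ∧ Q a :=
  (hP.imp hQ.not).not.congr (by simp)

theorem IsDefinableOver.iff (hP : IsDefinableOver U A σ P) (hQ : IsDefinableOver U A σ Q) :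
    IsDefinableOver U A σ fun a => P a ↔ Q a :=
  ((hP.imp hQ).and (hQ.imp hP)).congr (fun _ => iff_def)

theorem IsDefinableOver.comp (hP : IsDefinableOver U A σ P) {f : U.Tuple τ → U.Tuple σ}
    (hf : IsTermMap f) : IsDefinableOver U A τ fun a => P (f a) := by
  obtain ⟨J, _, b, hb, R, hR, h⟩ := isDefinableOver_iff.mp hP
  exact isDefinableOver_iff.mpr ⟨J, inferInstance, b, hb, fun x c => R (f x) c,
    hR.comp (f := fun a : U.Tuple (Sum.elim τ (repSorts b)) => join (f (lft a)) (rgt a))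
      ((hf.comp IsTermMap.inl).join IsTermMap.inr), fun c hc x => h c hc (f x)⟩

theorem IsDefinableOver.all [Finite W] {R : U.Tuple σ → U.Tuple τ → Prop}
    (hR : IsDefinableOver U A (Sum.elim σ τ) fun a => R (lft a) (rgt a)) :
    IsDefinableOver U A σ fun a => ∀ b, R a b := by
  obtain ⟨J, _, b, hb, R', hR', h⟩ := isDefinableOver_iff.mp hR
  refine isDefinableOver_iff.mpr ⟨J, inferInstance, b, hb, fun x c => ∀ y, R' (join x y) c,
    IsDefinable.all ?_, fun c hc x => forall_congr' fun y => h c hc (join x y)⟩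
  exact hR'.comp (f := fun a : U.Tuple (Sum.elim (Sum.elim σ (repSorts b)) τ) =>
    join (join (lft (lft a)) (rgt a)) (rgt (lft a)))
    (((IsTermMap.inl.comp IsTermMap.inl).join IsTermMap.inr).join
      (IsTermMap.inr.comp IsTermMap.inl))

theorem IsDefinableOver.ex [Finite W] {R : U.Tuple σ → U.Tuple τ → Prop}
    (hR : IsDefinableOver U A (Sum.elim σ τ) fun a => R (lft a) (rgt a)) :
    IsDefinableOver U A σ fun a => ∃ b, R a b :=
  (IsDefinableOver.all (R := fun a b => ¬ R a b) hR.not).not.congr fun a => by simp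

theorem IsDefinableOver.forall_finite {ι : Type*} [Finite ι] {R : ι → U.Tuple σ → Prop}
    (hR : ∀ i, IsDefinableOver U A σ (R i)) : IsDefinableOver U A σ fun a => ∀ i, R i a := by
  have : ∀ s : Finset ι, IsDefinableOver U A σ fun a => ∀ i ∈ s, R i a := by
    classical
    intro s
    induction s using Finset.induction_on with
    | empty => exact IsDefinable.true.over.congr (by simp)
    | insert i s _ ih => exact ((hR i).and ih).congr (by simp)
  cases nonempty_fintype ι
  exact (this Finset.univ).congr (by simp)

theorem IsDefinableOver.exists_finite {ι : Type*} [Finite ι] {R : ι → U.Tuple σ → Prop}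
    (hR : ∀ i, IsDefinableOver U A σ (R i)) : IsDefinableOver U A σ fun a => ∃ i, R i a :=
  (IsDefinableOver.forall_finite fun i => (hR i).not).not.congr (by simp)

/-- A definable family of sets, each of which is definable, has definable instances. -/
theorem IsDefinableOver.trans (hP : IsDefinableOver U B σ P)
    (h : ∀ e ∈ B, IsDefinableOver U A e.1.sorts (· ∈ e.reps)) : IsDefinableOver U A σ P := by
  obtain ⟨J, _, b, hb, R, hR, hPR⟩ := isDefinableOver_iff.mp hP
  -- The truth value does not depend on the representatives of the parameters, so these may be
  -- quantified away.
  have : IsDefinableOver U A σ fun x => ∃ c, IsRep b c ∧ R x c := by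
    refine IsDefinableOver.ex (IsDefinableOver.and ?_ hR.over)
    refine IsDefinableOver.forall_finite fun j => (h (b j) (hb j)).comp ?_
    exact (IsTermMap.proj (σ := repSorts b) fun i => ⟨j, i⟩).comp IsTermMap.inr
  refine this.congr fun x => ⟨fun hx => ?_, ?_⟩
  · obtain ⟨c, hc⟩ := exists_isRep b
    exact ⟨c, hc, (hPR c hc x).mp hx⟩
  · rintro ⟨c, hc, hx⟩
    exact (hPR c hc x).mpr hx

/-- Replacement of imaginary parameters by the elements of `Q`, if these define the parameters
uniformly. -/
theorem IsDefinableOver.exists_isDefinable (hP : IsDefinableOver U A σ P) (Q : Set (U.Tuple τ))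
    (h : ∀ e ∈ A, ∃ T : U.Tuple e.1.sorts → U.Tuple τ → Prop,
      IsDefinable U (Sum.elim e.1.sorts τ) (fun a => T (lft a) (rgt a)) ∧
        ∀ c ∈ Q, ∀ a, a ∈ e.reps ↔ T a c) :
    ∃ R : U.Tuple σ → U.Tuple τ → Prop,
      IsDefinable U (Sum.elim σ τ) (fun a => R (lft a) (rgt a)) ∧ ∀ c ∈ Q, ∀ x, P x ↔ R x c := by
  obtain ⟨J, _, b, hb, R, hR, hPR⟩ := isDefinableOver_iff.mp hP
  choose T hT hTQ using fun j => h (b j) (hb j)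
  refine ⟨fun x c => ∃ d : U.Tuple (repSorts b), (∀ j, T j (fun i => d ⟨j, i⟩) c) ∧ R x d,
    IsDefinable.ex (IsDefinable.and (IsDefinable.forall_finite fun j => ?_) ?_),
    fun c hc x => ⟨fun hx => ?_, ?_⟩⟩
  · exact (hT j).comp (f := fun a : U.Tuple (Sum.elim (Sum.elim σ τ) (repSorts b)) =>
      join (fun i => rgt a ⟨j, i⟩) (rgt (lft a))) (((IsTermMap.proj (σ := repSorts b)
        fun i => ⟨j, i⟩).comp IsTermMap.inr).join (IsTermMap.inr.comp IsTermMap.inl))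
  · exact hR.comp (f := fun a : U.Tuple (Sum.elim (Sum.elim σ τ) (repSorts b)) =>
      join (lft (lft a)) (rgt a)) ((IsTermMap.inl.comp IsTermMap.inl).join IsTermMap.inr)
  · obtain ⟨d, hd⟩ := exists_isRep b
    exact ⟨d, fun j => (hTQ j c hc _).mp (hd j), (hPR d hd x).mp hx⟩
  · rintro ⟨d, hd, hx⟩
    exact (hPR d (fun j => (hTQ j c hc _).mpr (hd j)) x).mpr hx

/-- The representatives of a real element. -/
theorem mem_reps_real {s : L.Sorts} (c : U.carrier s) (a : U.Tuple (U.realSort s).sorts) :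
    a ∈ (U.real c).reps ↔ a (0 : Fin 1) = c := by
  refine (Quotient.eq (r := (U.realSort s).rel) (x := a) (y := fun _ => c)).trans ?_
  change a = (fun _ => c) ↔ _
  constructor
  · rintro rfl
    rfl
  · intro h
    funext i
    rw [Fin.eq_zero i]
    exact h

theorem isDefinableOver_eq_const [Finite V] (c : U.Tuple σ) (hc : ∀ x, U.real (c x) ∈ A) :
    IsDefinableOver U A σ (· = c) := by
  refine (IsDefinableOver.forall_finite fun x : V => (isDefinableOver_reps (hc x)).comp
    (IsTermMap.proj (σ := σ) fun _ : Fin 1 => x)).congr fun a => ?_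
  rw [funext_iff]
  exact forall_congr' fun x => (mem_reps_real (c x) fun _ => a x).symm

/-- Substitution of real parameters. -/
theorem IsDefinableOver.subst_right [Finite W] {R : U.Tuple σ → U.Tuple τ → Prop}
    (hR : IsDefinableOver U A (Sum.elim σ τ) fun a => R (lft a) (rgt a)) (c : U.Tuple τ)
    (hc : ∀ x, U.real (c x) ∈ A) : IsDefinableOver U A σ fun x => R x c := by
  refine (IsDefinableOver.ex (R := fun x d => d = c ∧ R x d)
    (((isDefinableOver_eq_const c hc).comp IsTermMap.inr).and hR)).congr fun x => ?_
  simp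

end IsDefinableOver

/-! ### Definable and algebraic closure -/

theorem mem_dclEq {A : Set U.Imaginary} {e : U.Imaginary} :
    e ∈ U.dclEq A ↔ IsDefinableOver U A e.1.sorts (· ∈ e.reps) := Iff.rfl

theorem dclEq_trans {A B : Set U.Imaginary} (h : B ⊆ U.dclEq A) : U.dclEq B ⊆ U.dclEq A :=
  fun _ he => IsDefinableOver.trans he fun _ hf => h hf

theorem Interdefinable.trans {A B C : Set U.Imaginary} (h : U.Interdefinable A B)
    (h' : U.Interdefinable B C) : U.Interdefinable A C :=
  ⟨h.1.trans (dclEq_trans h'.1), h'.2.trans (dclEq_trans h.2)⟩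

theorem subset_aclEq (A : Set U.Imaginary) : A ⊆ U.aclEq A := fun e he =>
  ⟨{e.2}, Set.finite_singleton _, rfl, isDefinableOver_reps he⟩

theorem aclEq_mono_of_subset_dclEq {A B : Set U.Imaginary} (h : A ⊆ U.dclEq B) :
    U.aclEq A ⊆ U.aclEq B := by
  rintro e ⟨F, hF, he, hFA⟩
  exact ⟨F, hF, he, IsDefinableOver.trans hFA fun _ hf => h hf⟩

theorem subset_dclEq (A : Set U.Imaginary) : A ⊆ U.dclEq A := fun _ he => isDefinableOver_reps he

/-- The representatives of a code are precisely the parameters for which its formula defines `X`, a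
condition expressible over any set that defines `X`. -/
theorem codes_subset_dclEq {A : Set U.Imaginary} {V : Type} [Finite V] {σ : V → L.Sorts}
    {X : Set (U.Tuple σ)} (hX : U.DefinableOver A X) : U.codes X ⊆ U.dclEq A := by
  rintro e ⟨φ, hφ⟩
  have : IsDefinableOver U A e.1.sorts fun c => ∀ x, x ∈ X ↔ φ.Holds (join x c) := by
    refine IsDefinableOver.all (IsDefinableOver.iff (P := fun a => rgt a ∈ X)
      (IsDefinableOver.comp (P := (· ∈ X)) hX IsTermMap.inr) ?_)
    exact IsDefinable.over (IsDefinable.comp (P := fun a => φ.Holds a) ⟨φ, fun _ => Iff.rfl⟩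
      (IsTermMap.inr.join IsTermMap.inl))
  exact this.congr hφ

/-! ### Equivalence relations with finitely many classes -/

/-- `R` is an equivalence relation with at most `N` classes. -/
def IsFiniteEquivalence {α : Type*} (R : α → α → Prop) (N : ℕ) : Prop :=
  ((∀ x, R x x) ∧ (∀ x y, R x y → R y x) ∧ (∀ x y z, R x y → R y z → R x z)) ∧
    ∀ f : Fin (N + 1) → α, ∃ i j, i ≠ j ∧ R (f i) (f j)

/-- The setoid of an equivalence relation with finitely many classes. -/
def IsFiniteEquivalence.setoid {α : Type*} {R : α → α → Prop} {N : ℕ}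
    (h : IsFiniteEquivalence R N) : Setoid α where
  r := R
  iseqv := ⟨h.1.1, h.1.2.1 _ _, h.1.2.2 _ _ _⟩

theorem IsFiniteEquivalence.finite {α : Type*} {R : α → α → Prop} {N : ℕ}
    (h : IsFiniteEquivalence R N) : Finite (Quotient h.setoid) := by
  by_contra hinf
  rw [not_finite_iff_infinite] at hinf
  obtain ⟨f⟩ : Nonempty (ℕ ↪ Quotient h.setoid) := ⟨Infinite.natEmbedding _⟩
  obtain ⟨i, j, hij, hR⟩ := h.2 fun i => (f i).out
  have : f i = f j := by
    rw [← Quotient.out_eq (f i), ← Quotient.out_eq (f j)]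
    exact Quotient.sound hR
  exact hij (Fin.ext (f.injective this))

theorem exists_isFiniteEquivalence {α : Type*} (r : Setoid α) [Finite (Quotient r)] :
    ∃ N, IsFiniteEquivalence r N := by
  refine ⟨Nat.card (Quotient r), ⟨r.refl, fun _ _ => r.symm, fun _ _ _ => r.trans⟩, fun f => ?_⟩
  by_contra! hf
  have hinj : Function.Injective fun i => (Quotient.mk r (f i)) := fun i j hij => by
    by_contra hne
    exact hf i j hne (Quotient.exact hij)
  have := Nat.card_le_card_of_injective _ hinj
  simp at this

section Composition

variable {A : Set U.Imaginary} {V V₁ V₂ V₃ : Type*} {σ : V → L.Sorts} {σ₁ : V₁ → L.Sorts}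
  {σ₂ : V₂ → L.Sorts} {σ₃ : V₃ → L.Sorts}

theorem IsDefinable.comp₂ {R : U.Tuple σ₁ → U.Tuple σ₂ → Prop}
    (hR : IsDefinable U (Sum.elim σ₁ σ₂) fun a => R (lft a) (rgt a))
    {f : U.Tuple σ → U.Tuple σ₁} {g : U.Tuple σ → U.Tuple σ₂} (hf : IsTermMap f)
    (hg : IsTermMap g) : IsDefinable U σ fun a => R (f a) (g a) :=
  hR.comp (hf.join hg)

theorem IsDefinableOver.comp₂ {R : U.Tuple σ₁ → U.Tuple σ₂ → Prop}
    (hR : IsDefinableOver U A (Sum.elim σ₁ σ₂) fun a => R (lft a) (rgt a))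
    {f : U.Tuple σ → U.Tuple σ₁} {g : U.Tuple σ → U.Tuple σ₂} (hf : IsTermMap f)
    (hg : IsTermMap g) : IsDefinableOver U A σ fun a => R (f a) (g a) :=
  hR.comp (hf.join hg)

theorem IsDefinableOver.comp₃ {R : U.Tuple σ₁ → U.Tuple σ₂ → U.Tuple σ₃ → Prop}
    (hR : IsDefinableOver U A (Sum.elim (Sum.elim σ₁ σ₂) σ₃)
      fun a => R (lft (lft a)) (rgt (lft a)) (rgt a))
    {f : U.Tuple σ → U.Tuple σ₁} {g : U.Tuple σ → U.Tuple σ₂} {h : U.Tuple σ → U.Tuple σ₃}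
    (hf : IsTermMap f) (hg : IsTermMap g) (hh : IsTermMap h) :
    IsDefinableOver U A σ fun a => R (f a) (g a) (h a) :=
  hR.comp ((hf.join hg).join hh)

end Composition

section FiniteEquivalence

variable {A : Set U.Imaginary} {V W : Type} [Finite V] {σ : V → L.Sorts}
  {τ : W → L.Sorts}

/-- For fixed `N`, the bound on the number of classes is a pigeonhole statement about `N + 1`
tuples, hence first-order. This allows the property to be transferred to conjugates and along types.
-/
theorem IsDefinableOver.isFiniteEquivalence {R : U.Tuple σ → U.Tuple σ → U.Tuple τ → Prop}
    (hR : IsDefinableOver U A (Sum.elim (Sum.elim σ σ) τ)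
      fun a => R (lft (lft a)) (rgt (lft a)) (rgt a)) (N : ℕ) :
    IsDefinableOver U A τ fun c => IsFiniteEquivalence (fun x y => R x y c) N := by
  refine IsDefinableOver.and (.and (.all ?_) (.and (.all (.all (.imp ?_ ?_)))
    (.all (.all (.all (.imp ?_ (.imp ?_ ?_))))))) ?_
  · exact hR.comp₃ IsTermMap.inr IsTermMap.inr IsTermMap.inl
  · exact hR.comp₃ (IsTermMap.inr.comp IsTermMap.inl) IsTermMap.inr
      (IsTermMap.inl.comp IsTermMap.inl)
  · exact hR.comp₃ IsTermMap.inr (IsTermMap.inr.comp IsTermMap.inl)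
      (IsTermMap.inl.comp IsTermMap.inl)
  · exact hR.comp₃ (IsTermMap.inr.comp (IsTermMap.inl.comp IsTermMap.inl))
      (IsTermMap.inr.comp IsTermMap.inl) (IsTermMap.inl.comp (IsTermMap.inl.comp IsTermMap.inl))
  · exact hR.comp₃ (IsTermMap.inr.comp IsTermMap.inl) IsTermMap.inr
      (IsTermMap.inl.comp (IsTermMap.inl.comp IsTermMap.inl))
  · exact hR.comp₃ (IsTermMap.inr.comp (IsTermMap.inl.comp IsTermMap.inl)) IsTermMap.inr
      (IsTermMap.inl.comp (IsTermMap.inl.comp IsTermMap.inl))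
  · have : IsDefinableOver U A τ fun c => ∀ g : U.Tuple (fun p : Fin (N + 1) × V => σ p.2),
        ∃ i j, i ≠ j ∧ R (fun x => g (i, x)) (fun x => g (j, x)) c := by
      refine .all (.exists_finite fun i => .exists_finite fun j => .and ?_ ?_)
      · by_cases hij : i = j
        · exact IsDefinable.false.over.congr (by simp [hij])
        · exact IsDefinable.true.over.congr (by simp [hij])
      · exact hR.comp₃
          ((IsTermMap.proj (σ := fun p : Fin (N + 1) × V => σ p.2) fun x => (i, x)).comp
            IsTermMap.inr)
          ((IsTermMap.proj (σ := fun p : Fin (N + 1) × V => σ p.2) fun x => (j, x)).comp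
            IsTermMap.inr) IsTermMap.inl
    exact this.congr fun c => ⟨fun h g => h fun i x => g (i, x), fun h f => h fun p => f p.1 p.2⟩

theorem IsDefinableOver.finite_class {J : Type} [Finite J] {b : J → U.Imaginary}
    {F : ∀ j, Set (b j).1.Elem}
    (hF : ∀ j, U.DefinableOver A {a | (Quotient.mk (b j).1.rel a : (b j).1.Elem) ∈ F j}) :
    IsDefinableOver U A (repSorts b)
      fun c => ∀ j, (Quotient.mk (b j).1.rel fun i => c ⟨j, i⟩ : (b j).1.Elem) ∈ F j :=
  .forall_finite fun j => IsDefinableOver.comp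
    (P := fun a => (Quotient.mk (b j).1.rel a : (b j).1.Elem) ∈ F j) (hF j)
    (IsTermMap.proj (σ := repSorts b) fun i => ⟨j, i⟩)

/-- An `acl^eq(A)`-definable finite equivalence relation is refined by an `A`-definable one. -/
theorem exists_finer_isFiniteEquivalence {R : U.Tuple σ → U.Tuple σ → Prop} {N : ℕ}
    (hR : IsFiniteEquivalence R N)
    (hdef : IsDefinableOver U (U.aclEq A) (Sum.elim σ σ) fun a => R (lft a) (rgt a)) :
    ∃ (R' : U.Tuple σ → U.Tuple σ → Prop) (N' : ℕ), IsFiniteEquivalence R' N' ∧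
      IsDefinableOver U A (Sum.elim σ σ) (fun a => R' (lft a) (rgt a)) ∧
      ∀ x y, R' x y → R x y := by
  obtain ⟨J, _, b, hb, ρ, hρ, hRρ⟩ := isDefinableOver_iff.mp hdef
  choose F hF hbF hFA using hb
  let cls : U.Tuple (repSorts b) → ∀ j, (b j).1.Elem :=
    fun c j => Quotient.mk (b j).1.rel fun i => c ⟨j, i⟩
  -- Good tuples represent candidates for conjugates of `b`: their classes lie in the finite
  -- `A`-definable sets `F j`, and they yield a finite equivalence relation that is independent of
  -- the representatives.
  let Good : U.Tuple (repSorts b) → Prop := fun c => (∀ j, cls c j ∈ F j) ∧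
    IsFiniteEquivalence (fun x y => ρ (join x y) c) N ∧
    ∀ c', (∀ j, (b j).1.rel (fun i => c' ⟨j, i⟩) (fun i => c ⟨j, i⟩)) →
      ∀ a, ρ a c' ↔ ρ a c
  have hGood : IsDefinableOver U A (repSorts b) Good := by
    refine .and (IsDefinableOver.finite_class hFA) (.and ?_ (IsDefinable.over ?_))
    · exact IsDefinableOver.isFiniteEquivalence (IsDefinable.over
        (hρ.comp₂ ((IsTermMap.inl.comp IsTermMap.inl).join (IsTermMap.inr.comp IsTermMap.inl))
          IsTermMap.inr)) N
    · refine .all (.imp (.forall_finite fun j => .rel ?_ ?_) (.all (.iff ?_ ?_)))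
      · exact (IsTermMap.proj (σ := repSorts b) fun i => ⟨j, i⟩).comp IsTermMap.inr
      · exact (IsTermMap.proj (σ := repSorts b) fun i => ⟨j, i⟩).comp IsTermMap.inl
      · exact hρ.comp₂ IsTermMap.inr (IsTermMap.inr.comp IsTermMap.inl)
      · exact hρ.comp₂ IsTermMap.inr (IsTermMap.inl.comp IsTermMap.inl)
  let T : Set (∀ j, (b j).1.Elem) := {t | ∀ j, t j ∈ F j}
  have hT : Finite T := (Set.Finite.pi' hF).to_subtype
  have hsim : ∀ {c c'}, cls c' = cls c →
      ∀ j, (b j).1.rel (fun i => c' ⟨j, i⟩) (fun i => c ⟨j, i⟩) :=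
    fun h j => Quotient.exact (congrFun h j)
  -- the relation attached to a tuple of conjugates of the parameters
  let r : T → Setoid (U.Tuple σ) := fun t =>
    { r := fun x y => ∀ c, Good c → cls c = t.1 → ρ (join x y) c
      iseqv := ⟨fun x c hc _ => hc.2.1.1.1 x, fun h c hc ht => hc.2.1.1.2.1 _ _ (h c hc ht),
        fun h h' c hc ht => hc.2.1.1.2.2 _ _ _ (h c hc ht) (h' c hc ht)⟩ }
  have hr : ∀ t, Finite (Quotient (r t)) := by
    intro t
    by_cases ht : ∃ c, Good c ∧ cls c = t.1
    · obtain ⟨c, hc, hct⟩ := ht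
      have := hc.2.1.finite
      refine Finite.of_injective (β := Quotient hc.2.1.setoid)
        (Quotient.map id fun x y hxy => hxy c hc hct) ?_
      rintro ⟨x⟩ ⟨y⟩ hxy
      refine Quotient.sound fun c' hc' hct' => ?_
      exact (hc.2.2 c' (hsim (hct'.trans hct.symm)) _).mpr (Quotient.exact hxy)
    · have : Subsingleton (Quotient (r t)) := by
        refine ⟨?_⟩
        rintro ⟨x⟩ ⟨y⟩
        exact Quotient.sound fun c hc hct => (ht ⟨c, hc, hct⟩).elim
      infer_instance
  -- The refinement is the intersection of the relations of all good tuples. Only finitely many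
  -- different relations occur, so its quotient embeds in a finite product of finite quotients.
  let r' : Setoid (U.Tuple σ) :=
    { r := fun x y => ∀ c, Good c → ρ (join x y) c
      iseqv := ⟨fun x c hc => hc.2.1.1.1 x, fun h c hc => hc.2.1.1.2.1 _ _ (h c hc),
        fun h h' c hc => hc.2.1.1.2.2 _ _ _ (h c hc) (h' c hc)⟩ }
  have : Finite (Quotient r') := by
    refine Finite.of_injective (β := ∀ t, Quotient (r t))
      (fun q t => Quotient.map id (fun x y (hxy : ∀ c, Good c → ρ (join x y) c) c hc _ =>
        hxy c hc) q) ?_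
    rintro ⟨x⟩ ⟨y⟩ hxy
    exact Quotient.sound fun c hc =>
      Quotient.exact (congrFun hxy ⟨cls c, hc.1⟩) c hc rfl
  obtain ⟨N', hN'⟩ := exists_isFiniteEquivalence r'
  refine ⟨_, N', hN', .all (.imp (hGood.comp IsTermMap.inr) (IsDefinable.over ?_)), ?_⟩
  · exact hρ.comp₂ ((IsTermMap.inl.comp IsTermMap.inl).join (IsTermMap.inr.comp IsTermMap.inl))
      IsTermMap.inr
  · intro x y hxy
    obtain ⟨c, hc⟩ := exists_isRep b
    have hc' : ∀ c', (∀ j, (b j).1.rel (fun i => c' ⟨j, i⟩) (fun i => c ⟨j, i⟩)) → IsRep b c' :=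
      fun c' h j => (Imaginary.mem_reps_iff (hc j) _).mpr (h j)
    refine (hRρ c hc (join x y)).mpr (hxy c ⟨fun j => ?_, ?_, fun c' h a => ?_⟩)
    · rw [show cls c j = (b j).2 from hc j]
      exact hbF j
    · exact (show R = fun x y => ρ (join x y) c from
        funext fun x => funext fun y => propext (hRρ c hc (join x y))) ▸ hR
    · rw [← hRρ c hc, ← hRρ c' (hc' c' h)]

/-- An `acl^eq(A)`-definable set is invariant under an `A`-definable finite equivalence
relation. -/
theorem exists_isFiniteEquivalence_of_aclEq {D : U.Tuple σ → Prop}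
    (hD : IsDefinableOver U (U.aclEq A) σ D) :
    ∃ (R : U.Tuple σ → U.Tuple σ → Prop) (N : ℕ), IsFiniteEquivalence R N ∧
      IsDefinableOver U A (Sum.elim σ σ) (fun a => R (lft a) (rgt a)) ∧
      ∀ x y, R x y → (D x ↔ D y) := by
  -- The kernel of `D`, viewed as a map to `Prop`, has at most two classes; refining it gives the
  -- required relation.
  let r : Setoid (U.Tuple σ) := Setoid.comap D ⟨Eq, eq_equivalence⟩
  have : Finite (Quotient r) := by
    refine Finite.of_injective (β := Prop) (Quotient.lift D fun x y h => h) ?_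
    rintro ⟨x⟩ ⟨y⟩ h
    exact Quotient.sound h
  obtain ⟨N, hN⟩ := exists_isFiniteEquivalence r
  obtain ⟨R, N', hR, hdef, h⟩ := exists_finer_isFiniteEquivalence (A := A) hN
    (((hD.comp IsTermMap.inl).iff (hD.comp IsTermMap.inr)).congr fun a => eq_iff_iff)
  exact ⟨R, N', hR, hdef, fun x y hxy => iff_of_eq (h x y hxy)⟩

/-- A `∅`-definable equivalence relation gives a sort of `U^eq`. -/
theorem exists_eqSort (r : Setoid (U.Tuple σ))
    (hr : IsDefinable U (Sum.elim σ σ) fun a => r (lft a) (rgt a)) :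
    ∃ (S : U.EqSort) (h : U.Tuple S.sorts ≃ U.Tuple σ), IsTermMap h ∧
      ∀ a a', S.rel a a' ↔ r (h a) (h a') := by
  obtain ⟨n, ⟨e⟩⟩ := Finite.exists_equiv_fin V
  obtain ⟨σ', h, hh, -⟩ := exists_reindex (U := U) e σ
  obtain ⟨φ, hφ⟩ : IsDefinable U (Sum.elim σ' σ') fun a => r (h (lft a)) (h (rgt a)) :=
    hr.comp₂ (hh.comp IsTermMap.inl) (hh.comp IsTermMap.inr)
  exact ⟨⟨n, σ', r.comap h, φ, fun a b => hφ (join a b)⟩, h, hh, fun _ _ => Iff.rfl⟩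

/-- A `∅`-definable family of sets has a sort of canonical parameters. -/
theorem exists_eqSort_of_family [Finite W] (R : U.Tuple τ → U.Tuple σ → Prop)
    (hR : IsDefinable U (Sum.elim τ σ) fun a => R (lft a) (rgt a)) :
    ∃ (S : U.EqSort) (h : U.Tuple S.sorts ≃ U.Tuple σ), IsTermMap h ∧
      ∀ a a', S.rel a a' ↔ ∀ x, R x (h a) ↔ R x (h a') := by
  refine exists_eqSort ⟨fun c c' => ∀ x, R x c ↔ R x c', fun c x => Iff.rfl,
    fun h x => (h x).symm, fun h h' x => (h x).trans (h' x)⟩ (.all (.iff ?_ ?_))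
  · exact hR.comp₂ IsTermMap.inr (IsTermMap.inl.comp IsTermMap.inl)
  · exact hR.comp₂ IsTermMap.inr (IsTermMap.inr.comp IsTermMap.inl)

/-- A set that is invariant under an `A`-definable finite equivalence relation is
`acl^eq(A)`-definable. -/
theorem isDefinableOver_aclEq_of_invariant {R : U.Tuple σ → U.Tuple σ → Prop} {N : ℕ}
    (hR : IsFiniteEquivalence R N)
    (hdef : IsDefinableOver U A (Sum.elim σ σ) fun a => R (lft a) (rgt a))
    {D : U.Tuple σ → Prop} (hD : ∀ x y, R x y → (D x ↔ D y)) :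
    IsDefinableOver U (U.aclEq A) σ D := by
  obtain ⟨J, _, b, hb, ρ, hρ, hRρ⟩ := isDefinableOver_iff.mp hdef
  have hρ' : IsDefinable U (Sum.elim σ (Sum.elim σ (repSorts b)))
      fun a => ρ (join (lft a) (lft (rgt a))) (rgt (rgt a)) :=
    hρ.comp₂ (IsTermMap.inl.join (IsTermMap.inl.comp IsTermMap.inr))
      (IsTermMap.inr.comp IsTermMap.inr)
  obtain ⟨S, h, hh, hS⟩ := exists_eqSort_of_family
    (fun x d : U.Tuple _ => ρ (join x (lft d)) (rgt d)) hρ'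
  obtain ⟨c, hc⟩ := exists_isRep b
  have hRc : ∀ x y, ρ (join x y) c ↔ R x y := fun x y => (hRρ c hc (join x y)).symm
  -- `g z` is a canonical parameter of the `R`-class of `z`.
  let g : U.Tuple σ → S.Elem := fun z => Quotient.mk S.rel (h.symm (join z c))
  have hg : ∀ z z', R z z' → g z = g z' := fun z z' hz => Quotient.sound <| by
    refine (hS _ _).mpr fun x => ?_
    simp only [Equiv.apply_symm_apply]
    change ρ (join x z) c ↔ ρ (join x z') c
    rw [hRc, hRc]
    exact ⟨fun hx => hR.1.2.2 _ _ _ hx hz, fun hx => hR.1.2.2 _ _ _ hx (hR.1.2.1 _ _ hz)⟩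
  have hfin : (Set.range g).Finite := by
    have := hR.finite
    refine (Set.finite_range (Quotient.lift (s := hR.setoid) g hg)).subset ?_
    rintro _ ⟨z, rfl⟩
    exact ⟨Quotient.mk _ z, rfl⟩
  have hmk : ∀ (a : U.Tuple S.sorts) z, (Quotient.mk S.rel a : S.Elem) = g z ↔
      ∀ x, ρ (join x (lft (h a))) (rgt (h a)) ↔ R x z := by
    intro a z
    refine Quotient.eq.trans ((hS _ _).trans (forall_congr' fun x => ?_))
    simp only [Equiv.apply_symm_apply]
    exact iff_congr Iff.rfl (hRc x z)
  -- The set of the codes of all `R`-classes is finite and `A`-definable, so every one of them is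
  -- algebraic over `A`.
  have hacl : ∀ z, (⟨S, g z⟩ : U.Imaginary) ∈ U.aclEq A := by
    refine fun z => ⟨Set.range g, hfin, ⟨z, rfl⟩, ?_⟩
    have : IsDefinableOver U A S.sorts fun a => ∃ z : U.Tuple σ, ∀ x : U.Tuple σ,
        ρ (join x (lft (h a))) (rgt (h a)) ↔ R x z := by
      refine .ex (.all (.iff (IsDefinable.over ?_) ?_))
      · exact IsDefinable.comp₂ (R := fun x d => ρ (join x (lft d)) (rgt d)) hρ' IsTermMap.inr (hh.comp (IsTermMap.inl.comp IsTermMap.inl))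
      · exact hdef.comp₂ IsTermMap.inr (IsTermMap.inr.comp IsTermMap.inl)
    refine this.congr fun a => exists_congr fun z => ?_
    rw [eq_comm, hmk]
  -- By invariance, `D` is the union of the finitely many classes with codes in `I`.
  let I : Set S.Elem := {q | ∃ z, D z ∧ g z = q}
  have hI : Finite I :=
    (hfin.subset (by rintro _ ⟨z, _, rfl⟩; exact ⟨z, rfl⟩)).to_subtype
  have : IsDefinableOver U (U.aclEq A) σ fun x => ∃ q : I, ∃ a : U.Tuple S.sorts,
      a ∈ Imaginary.reps (⟨S, q.1⟩ : U.Imaginary) ∧ ρ (join x (lft (h a))) (rgt (h a)) := by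
    refine .exists_finite fun q => .ex (.and ?_ (IsDefinable.over ?_))
    · obtain ⟨_, z, hz, rfl⟩ := q
      exact (isDefinableOver_reps (hacl z)).comp IsTermMap.inr
    · exact IsDefinable.comp₂ (R := fun x d => ρ (join x (lft d)) (rgt d)) hρ' IsTermMap.inl (hh.comp IsTermMap.inr)
  refine this.congr fun x => ⟨fun hx => ⟨⟨g x, x, hx, rfl⟩, h.symm (join x c), rfl, ?_⟩, ?_⟩
  · rw [Equiv.apply_symm_apply]
    exact (hRc x x).mpr (hR.1.1 x)
  · rintro ⟨⟨_, z, hz, rfl⟩, a, ha, hx⟩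
    exact (hD x z (((hmk a z).mp ha x).mp hx)).mpr hz

/-- The class `e` is invariant under an `A`-definable finite equivalence relation `R`. Among the
elements of the sort of `e`, only finitely many are unions of `R`-classes, and the set of these is
`A`-definable. -/
theorem dclEq_aclEq_subset (A : Set U.Imaginary) : U.dclEq (U.aclEq A) ⊆ U.aclEq A := by
  intro e he
  obtain ⟨R, N, hR, hdef, h⟩ := exists_isFiniteEquivalence_of_aclEq (mem_dclEq.mp he)
  let F : Set e.1.Elem := {f | ∀ a a', Quotient.mk e.1.rel a = f → R a a' →
    Quotient.mk e.1.rel a' = f}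
  refine ⟨F, ?_, fun a a' ha haa' => (h a a' haa').mp ha, ?_⟩
  · have := hR.finite
    refine Set.finite_coe_iff.mp ?_
    -- An `R`-invariant class is determined by the `R`-class of any one of its members.
    refine Finite.of_injective (β := Quotient hR.setoid) (fun f => Quotient.mk _ f.1.out) ?_
    rintro ⟨f, hf⟩ ⟨f', hf'⟩ hff
    have := hf f.out f'.out (Quotient.out_eq f) (Quotient.exact hff)
    exact Subtype.ext (this.symm.trans (Quotient.out_eq f'))
  · have : IsDefinableOver U A e.1.sorts fun c => ∀ a a' : U.Tuple e.1.sorts,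
        e.1.rel a c → R a a' → e.1.rel a' c := by
      refine .all (.all (.imp (IsDefinable.over (.rel ?_ ?_)) (.imp (hdef.comp₂ ?_ ?_)
        (IsDefinable.over (.rel ?_ ?_)))))
      · exact IsTermMap.inr.comp IsTermMap.inl
      · exact IsTermMap.inl.comp IsTermMap.inl
      · exact IsTermMap.inr.comp IsTermMap.inl
      · exact IsTermMap.inr
      · exact IsTermMap.inr
      · exact IsTermMap.inl.comp IsTermMap.inl
    exact this.congr fun c => forall₂_congr fun a a' =>
      imp_congr Quotient.eq (imp_congr Iff.rfl Quotient.eq)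

end FiniteEquivalence

/-! ### Global types -/

section GlobalType

variable {A : Set U.Imaginary} {V W : Type} {σ : V → L.Sorts}
  {τ : W → L.Sorts}

theorem IsDefinable.definableOver_univ [Finite W] {R : U.Tuple σ → U.Tuple τ → Prop}
    (hR : IsDefinable U (Sum.elim σ τ) fun a => R (lft a) (rgt a)) (c : U.Tuple τ) :
    U.DefinableOver Set.univ {x | R x c} :=
  IsDefinableOver.subst_right hR.over c fun _ => Set.mem_univ _

theorem exists_real_parameters {X : Set (U.Tuple σ)} (hX : U.DefinableOver A X) :
    ∃ (W : Type) (_ : Finite W) (τ : W → L.Sorts) (c : U.Tuple τ)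
      (R : U.Tuple σ → U.Tuple τ → Prop),
      IsDefinable U (Sum.elim σ τ) (fun a => R (lft a) (rgt a)) ∧ ∀ x, x ∈ X ↔ R x c := by
  obtain ⟨J, _, b, -, R, hR, h⟩ := isDefinableOver_iff.mp hX
  obtain ⟨c, hc⟩ := exists_isRep b
  exact ⟨_, inferInstance, _, c, R, hR, h c hc⟩

theorem IsDefinableOver.isDefinable {P : U.Tuple σ → Prop}
    (h : IsDefinableOver U (∅ : Set U.Imaginary) σ P) : IsDefinable U σ P := by
  obtain ⟨R, hR, h⟩ := h.exists_isDefinable (τ := (Empty.elim : Empty → L.Sorts)) Set.univ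
    fun e he => he.elim
  refine (hR.comp (f := fun a => join a fun x => x.elim)
    (IsTermMap.id.join fun x => x.elim)).congr fun a => h _ trivial a

theorem Automorphism.map_surjective (f : U.Automorphism) (a : U.Tuple σ) : ∃ b, f.map b = a :=
  ⟨fun x => (f.toEquiv _).symm (a x), funext fun _ => Equiv.apply_symm_apply _ _⟩

theorem IsDefinable.map_automorphism₂ {R : U.Tuple σ → U.Tuple τ → Prop}
    (hR : IsDefinable U (Sum.elim σ τ) fun a => R (lft a) (rgt a)) (f : U.Automorphism)
    (a : U.Tuple σ) (b : U.Tuple τ) : R (f.map a) (f.map b) ↔ R a b :=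
  hR.map_automorphism f (join a b)

theorem GlobalType.IsDefinableOver.mem [Finite W] {p : U.GlobalType σ} (hp : p.IsDefinableOver A)
    {R : U.Tuple σ → U.Tuple τ → Prop}
    (hR : IsDefinable U (Sum.elim σ τ) fun a => R (lft a) (rgt a)) :
    Structure.IsDefinableOver U A τ fun b => {x | R x b} ∈ p.sets := by
  obtain ⟨n, ⟨e⟩⟩ := Finite.exists_equiv_fin W
  obtain ⟨τ', h, hh, hh'⟩ := exists_reindex (U := U) e τ
  obtain ⟨φ, hφ⟩ : IsDefinable U (Sum.elim σ τ') fun a => R (lft a) (h (rgt a)) :=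
    hR.comp₂ IsTermMap.inl (hh.comp IsTermMap.inr)
  have := hp n τ' φ
  refine (IsDefinableOver.comp (P := (· ∈ p.defn φ)) this hh').congr fun b => ?_
  refine iff_of_eq (congrArg (· ∈ p.sets) (Set.ext fun x => ?_))
  refine Iff.trans ?_ (hφ (join x (h.symm b)))
  change R x b ↔ R x (h (h.symm b))
  rw [h.apply_symm_apply]

variable (p : U.GlobalType σ)

theorem GlobalType.univ_mem : Set.univ ∈ p.sets := by
  rcases p.mem_or_compl_mem Set.univ (IsDefinable.true.over : Structure.IsDefinableOver U _ σ _) with h | h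
  · exact h
  · rw [Set.compl_univ] at h
    exact (p.empty_notMem h).elim

theorem GlobalType.compl_mem_iff {X : Set (U.Tuple σ)} (hX : U.DefinableOver Set.univ X) :
    Xᶜ ∈ p.sets ↔ X ∉ p.sets := by
  refine ⟨fun h h' => p.empty_notMem ?_, (p.mem_or_compl_mem X hX).resolve_left⟩
  rw [← Set.inter_compl_self X]
  exact p.inter_mem _ h' _ h

theorem GlobalType.iInter_mem {ι : Type*} [Finite ι] {X : ι → Set (U.Tuple σ)}
    (h : ∀ i, X i ∈ p.sets) : {x | ∀ i, x ∈ X i} ∈ p.sets := by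
  have : ∀ s : Finset ι, {x | ∀ i ∈ s, x ∈ X i} ∈ p.sets := by
    classical
    intro s
    induction s using Finset.induction_on with
    | empty => simpa using p.univ_mem
    | insert i s _ ih =>
      convert p.inter_mem _ (h i) _ ih using 1
      ext x
      simp
  cases nonempty_fintype ι
  simpa using this Finset.univ

theorem GlobalType.exists_mem_of_iUnion {ι : Type*} [Finite ι] {X : ι → Set (U.Tuple σ)}
    {Y : Set (U.Tuple σ)} (hY : Y ∈ p.sets) (hYX : ∀ x ∈ Y, ∃ i, x ∈ X i)
    (hX : ∀ i, U.DefinableOver Set.univ (X i)) : ∃ i, X i ∈ p.sets := by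
  by_contra! h
  have h' := p.inter_mem _ hY _ (p.iInter_mem fun i => (p.compl_mem_iff (hX i)).mpr (h i))
  refine p.empty_notMem ?_
  convert h' using 1
  refine (Set.eq_empty_of_forall_notMem ?_).symm
  rintro x ⟨hx, hx'⟩
  obtain ⟨i, hi⟩ := hYX x hx
  exact hx' i hi

/-- The tuple `b` realizes the restriction of `p` to the real parameters `c`. -/
def GlobalType.IsRealization (c : U.Tuple τ) (b : U.Tuple σ) : Prop :=
  ∀ R : U.Tuple σ → U.Tuple τ → Prop,
    IsDefinable U (Sum.elim σ τ) (fun a => R (lft a) (rgt a)) → {x | R x c} ∈ p.sets → R b c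

variable {p}

theorem GlobalType.IsRealization.iff [Finite W] {c : U.Tuple τ} {b : U.Tuple σ} (h : p.IsRealization c b)
    {R : U.Tuple σ → U.Tuple τ → Prop}
    (hR : IsDefinable U (Sum.elim σ τ) fun a => R (lft a) (rgt a)) :
    {x | R x c} ∈ p.sets ↔ R b c :=
  ⟨h R hR, fun hb => not_not.mp fun hn => h (fun x c => ¬ R x c) hR.not
    ((p.compl_mem_iff (hR.definableOver_univ c)).mpr hn) hb⟩

/-- The formulas of `p` over the finite tuple `c` are finitely satisfiable because `p` is closed
under finite intersections and omits the empty set; saturation does the rest. -/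
theorem GlobalType.exists_isRealization [Finite W] {n : ℕ} {σ : Fin n → L.Sorts} {κ : Cardinal.{u}}
    (hκ : Cardinal.aleph0 < κ) (hsat : U.IsSaturated κ) (p : U.GlobalType σ) (c : U.Tuple τ) :
    ∃ b, p.IsRealization c b := by
  let A : Set (Σ s, U.carrier s) := Set.range fun y => ⟨τ y, c y⟩
  let Φ : Set (Formula L (Sum.elim σ (fun a : A => a.1.1))) :=
    {φ | {x | φ.Holds (join x fun a : A => a.1.2)} ∈ p.sets}
  have hA : Cardinal.mk A < κ :=
    (Cardinal.lt_aleph0_iff_set_finite.mpr (Set.finite_range _)).trans hκ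
  obtain ⟨b, hb⟩ := hsat A hA n σ Φ fun Φ₀ hΦ hfin => by
    have := hfin.to_subtype
    by_contra! hx
    have := p.iInter_mem (X := fun φ : Φ₀ => {x | φ.1.Holds (join x fun a : A => a.1.2)})
      fun φ => hΦ φ.2
    refine p.empty_notMem ?_
    convert this
    refine (Set.eq_empty_of_forall_notMem fun x hx' => ?_).symm
    obtain ⟨φ, hφ, h⟩ := hx x
    exact h (hx' ⟨φ, hφ⟩)
  refine ⟨b, fun R hR hp => ?_⟩
  obtain ⟨φ, hφ⟩ : IsDefinable U (Sum.elim σ fun a : A => a.1.1)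
      fun a => R (lft a) fun y => rgt a ⟨⟨τ y, c y⟩, y, rfl⟩ :=
    hR.comp₂ IsTermMap.inl ((IsTermMap.proj (σ := fun a : A => a.1.1)
      fun y => ⟨⟨τ y, c y⟩, y, rfl⟩).comp IsTermMap.inr)
  have h : ∀ x, R x c ↔ φ.Holds (join x fun a : A => a.1.2) := fun x =>
    hφ (join x fun a : A => a.1.2)
  simp only [h] at hp ⊢
  exact hb φ hp

theorem exists_automorphism [Finite V] [Finite W] {κ : Cardinal.{u}} (hκ : Cardinal.aleph0 < κ)
    (hhom : U.IsStronglyHomogeneous κ) (c : U.Tuple τ) (a b : U.Tuple σ)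
    (h : ∀ R : U.Tuple σ → U.Tuple τ → Prop,
      IsDefinable U (Sum.elim σ τ) (fun a => R (lft a) (rgt a)) → (R a c ↔ R b c)) :
    ∃ f : U.Automorphism, f.map c = c ∧ f.map a = b := by
  -- Homogeneity is applied to the concatenations of `a` and `b` with `c`, so that the automorphism
  -- also fixes `c`.
  obtain ⟨f, hf⟩ := hhom (ULift.{u} (V ⊕ W)) (fun x => Sum.elim σ τ x.down)
    (fun x => join a c x.down) (fun x => join b c x.down)
    ((Cardinal.lt_aleph0_of_finite _).trans hκ) fun φ => by
      refine h (fun a c => φ.Holds fun x => join a c x.down) ?_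
      refine IsDefinable.comp (P := fun a => φ.Holds a) ⟨φ, fun _ => Iff.rfl⟩ ?_
      refine IsTermMap.comp (g := fun (a : U.Tuple (Sum.elim σ τ)) (x : ULift.{u} (V ⊕ W)) => a x.down) ?_ (IsTermMap.inl.join IsTermMap.inr)
      exact IsTermMap.proj (σ := Sum.elim σ τ) fun x : ULift.{u} (V ⊕ W) => x.down
  exact ⟨f, funext fun y => hf ⟨Sum.inr y⟩, funext fun x => hf ⟨Sum.inl x⟩⟩

theorem GlobalType.IsRealization.exists_automorphism [Finite V] [Finite W] {κ : Cardinal.{u}}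
    (hκ : Cardinal.aleph0 < κ) (hhom : U.IsStronglyHomogeneous κ) {c : U.Tuple τ}
    {a b : U.Tuple σ} (ha : p.IsRealization c a) (hb : p.IsRealization c b) :
    ∃ f : U.Automorphism, f.map c = c ∧ f.map a = b :=
  Structure.exists_automorphism hκ hhom c a b fun _ hR => (ha.iff hR).symm.trans (hb.iff hR)

/-- The realizations of `p` over `c` carry an ultrafilter that contains `p`. -/
theorem GlobalType.exists_ultrafilter [Finite W] {n : ℕ} {σ : Fin n → L.Sorts} {κ : Cardinal.{u}}
    (hκ : Cardinal.aleph0 < κ) (hsat : U.IsSaturated κ) (p : U.GlobalType σ) (c : U.Tuple τ) :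
    ∃ F : Ultrafilter (U.Tuple σ), {b | p.IsRealization c b} ∈ F ∧ ∀ X ∈ p.sets, X ∈ F := by
  let F : Filter (U.Tuple σ) :=
    { sets := {S | ∃ X ∈ p.sets, X ∩ {b | p.IsRealization c b} ⊆ S}
      univ_sets := ⟨Set.univ, p.univ_mem, Set.subset_univ _⟩
      sets_of_superset := fun ⟨X, hX, h⟩ h' => ⟨X, hX, h.trans h'⟩
      inter_sets := fun ⟨X, hX, h⟩ ⟨Y, hY, h'⟩ => ⟨X ∩ Y, p.inter_mem X hX Y hY,
        fun _ hx => ⟨h ⟨hx.1.1, hx.2⟩, h' ⟨hx.1.2, hx.2⟩⟩⟩ }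
  have hF : F.NeBot := by
    refine ⟨fun h => ?_⟩
    obtain ⟨X, hX, hX'⟩ : ∅ ∈ F := h ▸ Filter.mem_bot
    obtain ⟨W', _, τ', d, R, hR, hXR⟩ := exists_real_parameters (p.definable X hX)
    -- Realizing `p` also over the parameters `d` of `X` gives a point of `X` that realizes `p` over
    -- `c`, so the filter is proper.
    obtain ⟨b, hb⟩ := p.exists_isRealization hκ hsat (join c d)
    refine hX' ⟨(hXR b).mpr (hb (fun x e => R x (rgt e)) ?_ ?_), fun R' hR' h' => ?_⟩
    · exact hR.comp₂ IsTermMap.inl (IsTermMap.inr.comp IsTermMap.inr)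
    · exact (Set.ext hXR : X = {x | R x d}) ▸ hX
    · exact hb (fun x e => R' x (lft e))
        (hR'.comp₂ IsTermMap.inl (IsTermMap.inl.comp IsTermMap.inr)) h'
  exact ⟨Ultrafilter.of F, Ultrafilter.of_le F ⟨Set.univ, p.univ_mem, fun _ h => h.2⟩,
    fun X hX => Ultrafilter.of_le F ⟨X, hX, fun _ h => h.1⟩⟩

end GlobalType

/-! ### Definable types in definable sets -/

/-- Adding a coordinate in front of a tuple of elements of one sort. -/
def consCoord {K : L.Sorts} {n : ℕ} (y : U.Tuple fun _ : Fin 1 => K)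
    (x : U.Tuple fun _ : Fin n => K) : U.Tuple fun _ : Fin (n + 1) => K :=
  Fin.cases (y 0) x

section

variable {K : L.Sorts} {n : ℕ}

theorem consCoord_zero_succ (a : U.Tuple fun _ : Fin (n + 1) => K) :
    consCoord (fun _ => a 0) (fun i => a i.succ) = a := by
  funext i
  refine Fin.cases ?_ (fun j => ?_) i <;> rfl

theorem map_consCoord (f : U.Automorphism) (y : U.Tuple fun _ : Fin 1 => K)
    (x : U.Tuple fun _ : Fin n => K) : f.map (consCoord y x) = consCoord (f.map y) (f.map x) := by
  funext i
  refine Fin.cases ?_ (fun j => ?_) i <;> rfl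

theorem IsTermMap.consCoord {V : Type*} {σ : V → L.Sorts}
    {f : U.Tuple σ → U.Tuple fun _ : Fin 1 => K} {g : U.Tuple σ → U.Tuple fun _ : Fin n => K}
    (hf : IsTermMap f) (hg : IsTermMap g) : IsTermMap fun a => Structure.consCoord (f a) (g a) :=
  fun i => Fin.cases (hf 0) (fun j => hg j) i

/-- Integration of conjugates of the type `q` along an ultrafilter. -/
theorem GlobalType.exists_integral (q : U.GlobalType fun _ : Fin n => K)
    (F : Ultrafilter (U.Tuple fun _ : Fin 1 => K))
    (g : (U.Tuple fun _ : Fin 1 => K) → U.Automorphism) :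
    ∃ s : U.GlobalType fun _ : Fin (n + 1) => K, ∀ Z, Z ∈ s.sets ↔
      U.DefinableOver Set.univ Z ∧
        ∀ᶠ y in (F : Filter _), {x | consCoord y ((g y).map x) ∈ Z} ∈ q.sets := by
  have hdef : ∀ Z : Set (U.Tuple fun _ : Fin (n + 1) => K), U.DefinableOver Set.univ Z →
      ∀ y, U.DefinableOver Set.univ {x | consCoord y ((g y).map x) ∈ Z} := by
    intro Z hZ y
    obtain ⟨W, _, τ, c, R, hR, hZR⟩ := exists_real_parameters hZ
    obtain ⟨y', hy⟩ := (g y).map_surjective y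
    obtain ⟨c', hc⟩ := (g y).map_surjective c
    -- Applying the inverse of `g y` to `y` and to the parameters of `Z` shows the set to be
    -- definable.
    have h : ∀ x, consCoord y ((g y).map x) ∈ Z ↔ R (consCoord y' x) c' := fun x => by
      rw [hZR, ← hR.map_automorphism₂ (g y) (consCoord y' x), map_consCoord, hy, hc]
    simp only [h]
    exact IsDefinable.definableOver_univ (R := fun x d => R (consCoord (lft d) x) (rgt d))
      (hR.comp₂ (IsTermMap.consCoord (IsTermMap.inl.comp IsTermMap.inr) IsTermMap.inl)
        (IsTermMap.inr.comp IsTermMap.inr)) (join y' c')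
  refine ⟨⟨{Z | U.DefinableOver Set.univ Z ∧
      ∀ᶠ y in (F : Filter _), {x | consCoord y ((g y).map x) ∈ Z} ∈ q.sets},
    fun Z hZ => hZ.1, ?_, ?_, ?_, ?_⟩, fun Z => Iff.rfl⟩
  · rintro ⟨-, h⟩
    obtain ⟨y, hy⟩ := h.exists
    exact q.empty_notMem hy
  · rintro X ⟨hX, hX'⟩ Y ⟨hY, hY'⟩
    refine ⟨IsDefinableOver.and hX hY, ?_⟩
    filter_upwards [hX', hY'] with y h h'
    exact q.inter_mem _ h _ h'
  · rintro X ⟨hX, hX'⟩ Y hY hXY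
    refine ⟨hY, ?_⟩
    filter_upwards [hX'] with y h
    exact q.superset_mem _ h _ (hdef Y hY y) fun x hx => hXY hx
  · intro X hX
    rcases F.em fun y => {x | consCoord y ((g y).map x) ∈ X} ∈ q.sets with h | h
    · exact Or.inl ⟨hX, h⟩
    · refine Or.inr ⟨IsDefinableOver.not hX, ?_⟩
      filter_upwards [h] with y hy
      exact (q.compl_mem_iff (hdef X hX y)).mpr hy

end

/-! ### Generic values of families of relations -/

section

variable {V J : Type} [Finite V] [Finite J] {σ : V → L.Sorts} {b : J → U.Imaginary}

/-- A family of relations indexed by a type `p` that are finite equivalence relations generically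
has a generic value, which is a finite equivalence relation. -/
theorem GlobalType.isFiniteEquivalence_generic {W : Type} [Finite W] {τ : W → L.Sorts}
    {p : U.GlobalType τ} {c : U.Tuple (repSorts b)} {y₀ : U.Tuple τ} (hy₀ : p.IsRealization c y₀)
    {ρ : U.Tuple (Sum.elim σ σ) → U.Tuple (Sum.elim (repSorts b) τ) → Prop}
    (hρ : IsDefinable U (Sum.elim (Sum.elim σ σ) (Sum.elim (repSorts b) τ))
      fun a => ρ (lft a) (rgt a)) {N : ℕ}
    (hN : IsFiniteEquivalence (fun z z' => ρ (join z z') (join c y₀)) N) :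
    IsFiniteEquivalence (fun z z' => {y | ρ (join z z') (join c y)} ∈ p.sets) N := by
  have hdef : ∀ z z', U.DefinableOver Set.univ {y | ρ (join z z') (join c y)} := fun z z' =>
    IsDefinable.definableOver_univ (R := fun y d => ρ (lft d) (join (rgt d) y))
      (hρ.comp₂ (IsTermMap.inl.comp IsTermMap.inr)
        ((IsTermMap.inr.comp IsTermMap.inr).join IsTermMap.inl)) (join (join z z') c)
  -- The property is first-order in `y` and `c` and holds at the realization `y₀`, so it holds on a
  -- set of `p`.
  have hH : {y | IsFiniteEquivalence (fun z z' => ρ (join z z') (join c y)) N} ∈ p.sets := by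
    refine (hy₀.iff (R := fun y c => IsFiniteEquivalence (fun z z' => ρ (join z z') (join c y)) N)
      (IsDefinableOver.isDefinable ?_)).mpr hN
    refine IsDefinableOver.isFiniteEquivalence
      (R := fun z z' a => ρ (join z z') (join (rgt a) (lft a))) (IsDefinable.over ?_) N
    exact hρ.comp₂ ((IsTermMap.inl.comp IsTermMap.inl).join (IsTermMap.inr.comp IsTermMap.inl))
      ((IsTermMap.inr.comp IsTermMap.inr).join (IsTermMap.inl.comp IsTermMap.inr))
  refine ⟨⟨fun z => ?_, fun z z' h => ?_, fun z z' z'' h h' => ?_⟩, fun f => ?_⟩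
  · exact p.superset_mem _ hH _ (hdef z z) fun y hy => hy.1.1 z
  · exact p.superset_mem _ (p.inter_mem _ hH _ h) _ (hdef z' z) fun y hy => hy.1.1.2.1 _ _ hy.2
  · exact p.superset_mem _ (p.inter_mem _ hH _ (p.inter_mem _ h _ h')) _ (hdef z z'')
      fun y hy => hy.1.1.2.2 _ _ _ hy.2.1 hy.2.2
  -- The equivalent pair may vary with `y`, but there are finitely many pairs, and `p` chooses one.
  · obtain ⟨⟨⟨i, j⟩, hij⟩, h⟩ := p.exists_mem_of_iUnion
      (X := fun k : {k : Fin (N + 1) × Fin (N + 1) // k.1 ≠ k.2} =>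
        {y | ρ (join (f k.1.1) (f k.1.2)) (join c y)}) hH
      (fun y hy => by
        obtain ⟨i, j, hij, h⟩ := hy.2 f
        exact ⟨⟨(i, j), hij⟩, h⟩) fun k => hdef _ _
    exact ⟨i, j, hij, h⟩

/-- The generic value of a family of relations is definable over the parameters of the family and
of the type. -/
theorem GlobalType.isDefinableOver_generic {W : Type} [Finite W] {τ : W → L.Sorts}
    {A : Set U.Imaginary} {p : U.GlobalType τ} (hp : p.IsDefinableOver A) (hb : ∀ j, b j ∈ A)
    {c : U.Tuple (repSorts b)} (hc : IsRep b c) {y₀ : U.Tuple τ} (hy₀ : p.IsRealization c y₀)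
    {ρ : U.Tuple σ → U.Tuple (Sum.elim (repSorts b) τ) → Prop}
    (hρ : IsDefinable U (Sum.elim σ (Sum.elim (repSorts b) τ)) fun a => ρ (lft a) (rgt a))
    (hind : ∀ c', IsRep b c' → ∀ z, ρ z (join c' y₀) ↔ ρ z (join c y₀)) :
    Structure.IsDefinableOver U A σ fun z => {y | ρ z (join c y)} ∈ p.sets := by
  have hrep : ∀ c', IsRep b c' ↔
      ∀ j, (b j).1.rel (fun i => c' ⟨j, i⟩) (fun i => c ⟨j, i⟩) := fun c' =>
    forall_congr' fun j => Imaginary.mem_reps_iff (hc j) _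
  -- Independence of the representative holds at `y₀` and is first-order over `c`, hence holds
  -- generically. The tuple `c` can then be replaced by any representative and quantified away.
  have hI : {y | ∀ c', (∀ j, (b j).1.rel (fun i => c' ⟨j, i⟩) (fun i => c ⟨j, i⟩)) →
      ∀ z, ρ z (join c' y) ↔ ρ z (join c y)} ∈ p.sets := by
    refine (hy₀.iff (R := fun y c => ∀ c' : U.Tuple (repSorts b),
      (∀ j, (b j).1.rel (fun i => c' ⟨j, i⟩) (fun i => c ⟨j, i⟩)) →
      ∀ z, ρ z (join c' y) ↔ ρ z (join c y)) ?_).mpr fun c' h => hind c' ((hrep c').mpr h)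
    refine .all (.imp (.forall_finite fun j => .rel ?_ ?_) (.all (.iff ?_ ?_)))
    · exact (IsTermMap.proj (σ := repSorts b) fun i => ⟨j, i⟩).comp IsTermMap.inr
    · exact (IsTermMap.proj (σ := repSorts b) fun i => ⟨j, i⟩).comp
        (IsTermMap.inr.comp IsTermMap.inl)
    · exact hρ.comp₂ IsTermMap.inr ((IsTermMap.inr.comp IsTermMap.inl).join
        (IsTermMap.inl.comp (IsTermMap.inl.comp IsTermMap.inl)))
    · exact hρ.comp₂ IsTermMap.inr ((IsTermMap.inr.comp (IsTermMap.inl.comp IsTermMap.inl)).join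
        (IsTermMap.inl.comp (IsTermMap.inl.comp IsTermMap.inl)))
  have hdef : ∀ z c, U.DefinableOver Set.univ {y | ρ z (join c y)} := fun z c =>
    IsDefinable.definableOver_univ (R := fun y d => ρ (lft d) (join (rgt d) y))
      (hρ.comp₂ (IsTermMap.inl.comp IsTermMap.inr)
        ((IsTermMap.inr.comp IsTermMap.inr).join IsTermMap.inl)) (join z c)
  have hG : Structure.IsDefinableOver U A (Sum.elim σ (repSorts b))
      fun d => {y | ρ (lft d) (join (rgt d) y)} ∈ p.sets :=
    hp.mem (R := fun y d => ρ (lft d) (join (rgt d) y))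
      (hρ.comp₂ (IsTermMap.inl.comp IsTermMap.inr)
        ((IsTermMap.inr.comp IsTermMap.inr).join IsTermMap.inl))
  have : Structure.IsDefinableOver U A σ fun z => ∃ c', IsRep b c' ∧
      {y | ρ z (join c' y)} ∈ p.sets := by
    refine .ex (.and (.forall_finite fun j => (isDefinableOver_reps (hb j)).comp ?_) hG)
    exact (IsTermMap.proj (σ := repSorts b) fun i => ⟨j, i⟩).comp IsTermMap.inr
  refine this.congr fun z => ⟨fun h => ⟨c, hc, h⟩, ?_⟩
  rintro ⟨c', hc', h⟩
  exact p.superset_mem _ (p.inter_mem _ hI _ h) _ (hdef z c) fun y hy =>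
    (hy.1 c' ((hrep c').mp hc') z).mp hy.2

end

/-! ### From definable types on the line to definable types in powers -/

section

variable {K : L.Sorts} {n : ℕ} {κ : Cardinal.{u}}

/-- Fibrewise construction of a definable type in a definable set. -/
theorem exists_definable_type_succ (hκ : Cardinal.aleph0 < κ) (hsat : U.IsSaturated κ)
    (hhom : U.IsStronglyHomogeneous κ)
    (h₁ : ∀ (A : Set U.Imaginary) (X : Set (U.Tuple fun _ : Fin 1 => K)), X.Nonempty →
      U.DefinableOver A X → ∃ p : U.GlobalType fun _ : Fin 1 => K,
        X ∈ p.sets ∧ p.IsDefinableOver (U.aclEq A))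
    (hn : ∀ (A : Set U.Imaginary) (X : Set (U.Tuple fun _ : Fin n => K)), X.Nonempty →
      U.DefinableOver A X → ∃ p : U.GlobalType fun _ : Fin n => K,
        X ∈ p.sets ∧ p.IsDefinableOver (U.aclEq A))
    (A : Set U.Imaginary) (X : Set (U.Tuple fun _ : Fin (n + 1) => K)) (hXne : X.Nonempty)
    (hX : U.DefinableOver A X) :
    ∃ p : U.GlobalType fun _ : Fin (n + 1) => K, X ∈ p.sets ∧ p.IsDefinableOver (U.aclEq A) := by
  obtain ⟨J, _, b, hb, T, hT, hXb⟩ := isDefinableOver_iff.mp hX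
  obtain ⟨c, hc⟩ := exists_isRep b
  have hXT : ∀ a, a ∈ X ↔ T a c := hXb c hc
  obtain ⟨p, hYp, hp⟩ := h₁ A {y | ∃ x, consCoord y x ∈ X}
    (by
      obtain ⟨a, ha⟩ := hXne
      exact ⟨fun _ => a 0, fun i => a i.succ, by rwa [consCoord_zero_succ]⟩)
    (IsDefinableOver.ex (IsDefinableOver.comp (P := (· ∈ X)) hX
      (IsTermMap.consCoord IsTermMap.inl IsTermMap.inr)))
  obtain ⟨F, hPF, hpF⟩ := p.exists_ultrafilter hκ hsat c
  obtain ⟨y₀, hy₀⟩ := p.exists_isRealization hκ hsat c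
  -- When `y` does not realize `p` over `c` the automorphism is arbitrary; this is harmless because
  -- `F` concentrates on realizations.
  have hg : ∀ y, ∃ f : U.Automorphism, p.IsRealization c y → f.map c = c ∧ f.map y₀ = y := by
    intro y
    by_cases hy : p.IsRealization c y
    · obtain ⟨f, hf⟩ := hy₀.exists_automorphism hκ hhom hy
      exact ⟨f, fun _ => hf⟩
    · obtain ⟨f, -⟩ := hy₀.exists_automorphism hκ hhom hy₀
      exact ⟨f, fun h => (hy h).elim⟩
  choose g hg using hg
  -- a type in the fibre of `y₀`
  let A' : Set U.Imaginary := Set.range b ∪ {U.real (y₀ 0)}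
  have hy₀A' : ∀ i, U.real (y₀ i) ∈ A' := fun i => by
    rw [Fin.eq_zero i]
    exact Or.inr rfl
  have hXA' : U.DefinableOver A' X := isDefinableOver_iff.mpr
    ⟨J, inferInstance, b, fun j => Or.inl ⟨j, rfl⟩, T, hT, hXb⟩
  obtain ⟨q, hXq, hq⟩ := hn A' {x | consCoord y₀ x ∈ X}
    (by
      have : ∃ x, consCoord y₀ x ∈ X := by
        simp only [hXT] at hYp ⊢
        refine hy₀ (fun y c => ∃ x, T (consCoord y x) c) (.ex ?_) hYp
        exact hT.comp₂ (IsTermMap.consCoord (IsTermMap.inl.comp IsTermMap.inl) IsTermMap.inr)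
          (IsTermMap.inr.comp IsTermMap.inl)
      exact this)
    (IsDefinableOver.subst_right (R := fun x y => consCoord y x ∈ X)
      (IsDefinableOver.comp (P := (· ∈ X)) hXA' (IsTermMap.consCoord IsTermMap.inr IsTermMap.inl))
      y₀ hy₀A')
  obtain ⟨s, hs⟩ := q.exists_integral F g
  refine ⟨s, (hs X).mpr ⟨IsDefinableOver.mono hX (Set.subset_univ _), ?_⟩, fun m τ φ => ?_⟩
  · filter_upwards [hPF] with y hy
    obtain ⟨hgc, hgy⟩ := hg y hy
    convert hXq using 3 with x
    rw [hXT, hXT, ← hT.map_automorphism₂ (g y) (consCoord y₀ x), map_consCoord, hgc, hgy]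
  · have hφ : IsDefinable U (Sum.elim (fun _ : Fin (n + 1) => K) τ)
        fun a => φ.Holds (join (lft a) (rgt a)) :=
      IsDefinable.comp (P := fun a => φ.Holds a) ⟨φ, fun _ => Iff.rfl⟩
        (IsTermMap.inl.join IsTermMap.inr)
    have hD : IsDefinableOver U (U.aclEq A') τ
        fun z => {x | φ.Holds (join (consCoord y₀ x) z)} ∈ q.sets :=
      IsDefinableOver.subst_right
        (R := fun z y => {x | φ.Holds (join (consCoord y x) z)} ∈ q.sets)
        (hq.mem (R := fun x d => φ.Holds (join (consCoord (rgt d) x) (lft d)))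
          (IsDefinable.comp₂ (R := fun a z => φ.Holds (join a z)) hφ
            (IsTermMap.consCoord (IsTermMap.inr.comp IsTermMap.inr) IsTermMap.inl)
            (IsTermMap.inl.comp IsTermMap.inr)))
        y₀ fun i => subset_aclEq A' (hy₀A' i)
    -- The definition of `φ` in the fibre type is only algebraic over `b` and `y₀`; the relation
    -- `E₀` that preserves it is definable over them and so can be spread over a family in `y`.
    obtain ⟨E₀, N, hE₀, hE₀def, hinv⟩ := exists_isFiniteEquivalence_of_aclEq hD
    obtain ⟨ρ, hρ, hρE⟩ := hE₀def.exists_isDefinable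
      (τ := Sum.elim (repSorts b) fun _ : Fin 1 => K) {d | IsRep b (lft d) ∧ rgt d = y₀} (by
        rintro e (⟨j, rfl⟩ | rfl)
        · exact ⟨fun a d => (b j).1.rel a fun i => d (Sum.inl ⟨j, i⟩),
            .rel IsTermMap.inl ((IsTermMap.proj (σ := repSorts b) fun i => ⟨j, i⟩).comp
              (IsTermMap.inl.comp IsTermMap.inr)),
            fun d hd a => Imaginary.mem_reps_iff (hd.1 j) a⟩
        · refine ⟨fun a d => a = fun _ => d (Sum.inr 0), .eq_tuple IsTermMap.inl
            ((IsTermMap.proj (σ := fun _ : Fin 1 => K) fun _ : Fin 1 => 0).comp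
              (IsTermMap.inr.comp IsTermMap.inr)), fun d hd a => ?_⟩
          have hd0 : d (Sum.inr 0) = y₀ 0 := congrFun hd.2 0
          refine (mem_reps_real (y₀ 0) a).trans ⟨fun h => ?_, fun h => ?_⟩
          · funext i
            rw [show i = (0 : Fin 1) from Subsingleton.elim (α := Fin 1) i 0]
            exact h.trans hd0.symm
          · exact (congrFun h (0 : Fin 1)).trans hd0)
    have hρE₀ : ∀ c', IsRep b c' → ∀ a, ρ a (join c' y₀) ↔ E₀ (lft a) (rgt a) :=
      fun c' hc' a => (hρE (join c' y₀) ⟨hc', rfl⟩ a).symm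
    have hE : IsFiniteEquivalence
        (fun z z' => {y | ρ (join z z') (join c y)} ∈ p.sets) N := by
      refine GlobalType.isFiniteEquivalence_generic hy₀ hρ ?_
      simp only [hρE₀ c hc]
      exact hE₀
    have hEdef := GlobalType.isDefinableOver_generic hp (fun j => subset_aclEq A (hb j)) hc hy₀ hρ
      fun c' hc' a => (hρE₀ c' hc' a).trans (hρE₀ c hc a).symm
    -- The generic relation is definable over `acl^eq(A)`; refining it removes the algebraic
    -- parameters.
    obtain ⟨E, N', hE', hE'def, hEE'⟩ := exists_finer_isFiniteEquivalence (A := A) hE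
      (hEdef.congr fun a => by rw [join_lft_rgt])
    refine isDefinableOver_aclEq_of_invariant hE' hE'def
      (D := fun z => z ∈ s.defn φ) fun z z' hzz' => ?_
    have hdefn : ∀ z, U.DefinableOver Set.univ {a | φ.Holds (join a z)} := fun z =>
      IsDefinable.definableOver_univ (R := fun a z => φ.Holds (join a z)) hφ z
    refine (hs _).trans (Iff.trans ?_ (hs _).symm)
    refine and_congr (iff_of_true (hdefn z) (hdefn z')) (Filter.eventually_congr ?_)
    -- If `z` and `z'` are `E`-equivalent, then `ρ` relates them at `F`-almost every `y`. Pulling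
    -- back by `g y`, which sends `y₀` to `y` and fixes `c`, turns this into `E₀`-equivalence of the
    -- preimages, under which membership in the definition of `q` is invariant.
    filter_upwards [hPF, hpF _ (hEE' z z' hzz')] with y hy hyE
    obtain ⟨hgc, hgy⟩ := hg y hy
    have key : ∀ w, {x | φ.Holds (join (consCoord y ((g y).map x)) ((g y).map w))} =
        {x | φ.Holds (join (consCoord y₀ x) w)} := fun w => Set.ext fun x => by
      have h := IsDefinable.map_automorphism₂ (R := fun a z => φ.Holds (join a z)) hφ (g y)
        (consCoord y₀ x) w
      rwa [map_consCoord, hgy] at h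
    obtain ⟨w, rfl⟩ := (g y).map_surjective z
    obtain ⟨w', rfl⟩ := (g y).map_surjective z'
    change {x | φ.Holds (join (consCoord y ((g y).map x)) ((g y).map w))} ∈ q.sets ↔
      {x | φ.Holds (join (consCoord y ((g y).map x)) ((g y).map w'))} ∈ q.sets
    rw [key, key]
    refine hinv w w' ((hρE₀ c hc (join w w')).mp ?_)
    rw [← hρ.map_automorphism₂ (g y), Automorphism.map_join, Automorphism.map_join, hgc, hgy]
    exact hyE

end

theorem GlobalType.IsDefinableOver.mono {V : Type v} {σ : V → L.Sorts} {p : U.GlobalType σ}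
    {A B : Set U.Imaginary} (hp : p.IsDefinableOver A) (hAB : A ⊆ B) : p.IsDefinableOver B :=
  fun m τ φ => Structure.IsDefinableOver.mono (hp m τ φ) hAB

/-- The type of the tuple of length zero. -/
theorem exists_definable_type_zero {K : L.Sorts} (A : Set U.Imaginary)
    (X : Set (U.Tuple fun _ : Fin 0 => K)) (hXne : X.Nonempty) (hX : U.DefinableOver A X) :
    ∃ p : U.GlobalType fun _ : Fin 0 => K, X ∈ p.sets ∧ p.IsDefinableOver A := by
  obtain ⟨a, ha⟩ := hXne
  refine ⟨⟨{Z | U.DefinableOver Set.univ Z ∧ a ∈ Z}, fun Z hZ => hZ.1, fun h => h.2,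
    fun X hX Y hY => ⟨IsDefinableOver.and hX.1 hY.1, hX.2, hY.2⟩,
    fun X hX Y hY h => ⟨hY, h hX.2⟩, fun X hX => ?_⟩,
    ⟨IsDefinableOver.mono hX (Set.subset_univ _), ha⟩, fun m τ φ => ?_⟩
  · by_cases h : a ∈ X
    · exact Or.inl ⟨hX, h⟩
    · exact Or.inr ⟨IsDefinableOver.not hX, h⟩
  · have hφ : IsDefinable U (Sum.elim (fun _ : Fin 0 => K) τ)
        fun d => φ.Holds (join (lft d) (rgt d)) :=
      IsDefinable.comp (P := fun a => φ.Holds a) ⟨φ, fun _ => Iff.rfl⟩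
        (IsTermMap.inl.join IsTermMap.inr)
    have : IsDefinableOver U A τ fun b => φ.Holds (join a b) :=
      IsDefinable.over (hφ.comp (f := fun b => join (fun i => i.elim0) b)
        (IsTermMap.join (fun i => i.elim0) IsTermMap.id)) |>.congr fun b => by
          rw [show a = fun i => i.elim0 from funext fun i => i.elim0]
          exact Iff.rfl
    exact this.congr fun b => ⟨fun h => h.2, fun h =>
      ⟨IsDefinable.definableOver_univ (R := fun a z => φ.Holds (join a z)) hφ b, h⟩⟩

/-- If non-empty definable subsets of the sort `K` contain types that are definable over the
algebraic closure of their codes, then every non-empty `A`-definable subset of `Kⁿ` contains an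
`acl^eq(A)`-definable type. -/
theorem exists_definable_type {K : L.Sorts} {κ : Cardinal.{u}} (hκ : Cardinal.aleph0 < κ)
    (hsat : U.IsSaturated κ) (hhom : U.IsStronglyHomogeneous κ)
    (h_types : ∀ X : Set (U.Tuple (fun _ : Fin 1 => K)), X.Nonempty →
      U.DefinableOver Set.univ X →
      ∃ p : U.GlobalType (fun _ : Fin 1 => K),
        X ∈ p.sets ∧ p.IsDefinableOver (U.aclEq (U.codes X))) (n : ℕ) :
    ∀ (A : Set U.Imaginary) (X : Set (U.Tuple fun _ : Fin n => K)), X.Nonempty →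
      U.DefinableOver A X → ∃ p : U.GlobalType fun _ : Fin n => K,
        X ∈ p.sets ∧ p.IsDefinableOver (U.aclEq A) := by
  induction n with
  | zero =>
    intro A X hXne hX
    obtain ⟨p, hXp, hp⟩ := exists_definable_type_zero A X hXne hX
    exact ⟨p, hXp, hp.mono (subset_aclEq A)⟩
  | succ n ih =>
    refine exists_definable_type_succ hκ hsat hhom (fun A X hXne hX => ?_) ih
    obtain ⟨p, hXp, hp⟩ := h_types X hXne (IsDefinableOver.mono hX (Set.subset_univ _))
    exact ⟨p, hXp, hp.mono (aclEq_mono_of_subset_dclEq (codes_subset_dclEq hX))⟩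

/-! ### Codes -/

section Codes

variable {A : Set U.Imaginary} {V : Type} {σ : V → L.Sorts} {X : Set (U.Tuple σ)}

/-- A code is the class of a parameter of `X`, modulo defining the same member of the family. -/
theorem codes_nonempty [Finite V] (hX : U.DefinableOver A X) : (U.codes X).Nonempty := by
  obtain ⟨W, _, τ, c, R, hR, hXR⟩ := exists_real_parameters hX
  obtain ⟨S, h, hh, hS⟩ := exists_eqSort_of_family R hR
  obtain ⟨φ, hφ⟩ : IsDefinable U (Sum.elim σ S.sorts) fun a => R (lft a) (h (rgt a)) :=
    hR.comp₂ IsTermMap.inl (hh.comp IsTermMap.inr)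
  refine ⟨⟨S, Quotient.mk S.rel (h.symm c)⟩, φ, fun a => ?_⟩
  refine Quotient.eq.trans ((hS _ _).trans (forall_congr' fun x => ?_))
  rw [h.apply_symm_apply]
  exact Iff.comm.trans (iff_congr (hXR x).symm (hφ (join x a)))

theorem definableOver_of_mem_codes {e : U.Imaginary} (he : e ∈ U.codes X) (heA : e ∈ A) :
    U.DefinableOver A X := by
  obtain ⟨φ, hφ⟩ := he
  refine isDefinableOver_iff.mpr ⟨Unit, inferInstance, fun _ => e, fun _ => heA,
    fun x c => φ.Holds (join x fun i => c ⟨(), i⟩),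
    IsDefinable.comp (P := fun a => φ.Holds a) ⟨φ, fun _ => Iff.rfl⟩ (IsTermMap.inl.join
      (IsTermMap.comp (IsTermMap.proj (σ := repSorts fun _ : Unit => e) fun i => ⟨(), i⟩)
        IsTermMap.inr)), fun c hc x => (hφ _).mp (hc ()) x⟩

theorem GlobalType.codes_subset_dclEq {p : U.GlobalType σ} (hp : p.IsDefinableOver A) :
    p.codes ⊆ U.dclEq A := by
  rintro e ⟨m, τ, φ, he⟩
  exact Structure.codes_subset_dclEq (hp m τ φ) he

/-- An imaginary is a code of the set of its representatives. -/
theorem Imaginary.mem_codes_reps (e : U.Imaginary) : e ∈ U.codes e.reps := by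
  obtain ⟨φ, hφ⟩ := e.1.definable
  refine ⟨φ, fun c => ⟨fun hc x => (Imaginary.mem_reps_iff hc x).trans (hφ x c), fun h => ?_⟩⟩
  exact (h c).mpr ((hφ c c).mp (e.1.rel.refl c))

/-- An imaginary is definable from a type of tuples from which it is uniformly definable. -/
theorem Imaginary.mem_codes_of_mem {p : U.GlobalType σ} (e : U.Imaginary)
    {R : U.Tuple e.1.sorts → U.Tuple σ → Prop}
    (hR : IsDefinable U (Sum.elim e.1.sorts σ) fun a => R (lft a) (rgt a))
    (h : {y | ∀ x, x ∈ e.reps ↔ R x y} ∈ p.sets) : e ∈ p.codes := by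
  -- `ψ(y, c)` says that `R(·, y)` defines the class of `c`. Since `p`-almost every `y` defines `e`,
  -- the definition of `ψ` in `p` is the class `e` itself, and `e` is a code of it.
  obtain ⟨ψ, hψ⟩ : IsDefinable U (Sum.elim σ e.1.sorts)
      fun a => ∀ x, e.1.rel x (rgt a) ↔ R x (lft a) := by
    refine .all (.iff (.rel IsTermMap.inr (IsTermMap.inr.comp IsTermMap.inl)) ?_)
    exact hR.comp₂ IsTermMap.inr (IsTermMap.inl.comp IsTermMap.inl)
  refine ⟨_, _, ψ, ?_⟩
  suffices hd : p.defn ψ = e.reps by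
    rw [hd]
    exact e.mem_codes_reps
  ext c
  have hset : {y | ψ.Holds (join y c)} = {y | ∀ x, e.1.rel x c ↔ R x y} :=
    Set.ext fun y => (hψ (join y c)).symm
  change {y | ψ.Holds (join y c)} ∈ p.sets ↔ _
  rw [hset]
  refine ⟨fun h' => ?_, fun hc => ?_⟩
  · by_contra hc
    refine p.empty_notMem ?_
    convert p.inter_mem _ h _ h'
    refine (Set.eq_empty_of_forall_notMem ?_).symm
    rintro y ⟨hy, hy'⟩
    exact hc ((hy c).mpr ((hy' c).mp (e.1.rel.refl c)))
  · simpa only [Imaginary.mem_reps_iff hc] using h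

end Codes

/-- An imaginary that is definable from a finite tuple of elements of its algebraic closure is
interdefinable with a finite set of conjugates of this tuple. -/
theorem exists_interdefinable_finite {e : U.Imaginary} {k : ℕ} {t : Fin k → U.Imaginary}
    (ht : ∀ j, t j ∈ U.aclEq {e}) {R : U.Tuple e.1.sorts → U.Tuple (repSorts t) → Prop}
    (hR : IsDefinable U (Sum.elim e.1.sorts (repSorts t)) fun a => R (lft a) (rgt a))
    (he : ∀ c, IsRep t c → ∀ x, x ∈ e.reps ↔ R x c) :
    ∃ X : Set (∀ j, (t j).1.Elem), X.Finite ∧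
      U.Interdefinable {e} (U.codes (pullback (fun j => (t j).1) X)) := by
  choose F hF htF hFA using ht
  -- Keeping only the tuples in the product of the `F j` that define `e` through `R` makes `e`
  -- recoverable from any member of `X`, while `X` stays finite and `e`-definable.
  let X : Set (∀ j, (t j).1.Elem) := {f | (∀ j, f j ∈ F j) ∧
    ∀ c : U.Tuple (repSorts t),
      (∀ j, (Quotient.mk (t j).1.rel (fun i => c ⟨j, i⟩) : (t j).1.Elem) = f j) →
      ∀ x, x ∈ e.reps ↔ R x c}
  have hXdef : U.DefinableOver {e} (pullback (fun j => (t j).1) X) := by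
    have : IsDefinableOver U {e} (repSorts t) fun a =>
        (∀ j, (Quotient.mk (t j).1.rel (fun i => a ⟨j, i⟩) : (t j).1.Elem) ∈ F j) ∧
        ∀ c : U.Tuple (repSorts t),
          (∀ j, (t j).1.rel (fun i => c ⟨j, i⟩) (fun i => a ⟨j, i⟩)) →
          ∀ x, x ∈ e.reps ↔ R x c := by
      refine .and (IsDefinableOver.finite_class hFA) (.all (.imp (IsDefinable.over
        (.forall_finite fun j => .rel ?_ ?_)) (.all (.iff ?_ (IsDefinable.over ?_)))))
      · exact (IsTermMap.proj (σ := repSorts t) fun i => ⟨j, i⟩).comp IsTermMap.inr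
      · exact (IsTermMap.proj (σ := repSorts t) fun i => ⟨j, i⟩).comp IsTermMap.inl
      · exact (isDefinableOver_reps (Set.mem_singleton e)).comp IsTermMap.inr
      · exact hR.comp₂ IsTermMap.inr (IsTermMap.inr.comp IsTermMap.inl)
    exact this.congr fun a => and_congr Iff.rfl
      (forall_congr' fun c => imp_congr (forall_congr' fun j => Quotient.eq) Iff.rfl)
  refine ⟨X, (Set.Finite.pi' hF).subset fun f hf => hf.1, ?_, codes_subset_dclEq hXdef⟩
  refine Set.singleton_subset_iff.mpr ?_
  obtain ⟨e₀, he₀⟩ := codes_nonempty hXdef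
  have hX := definableOver_of_mem_codes he₀ he₀
  have : IsDefinableOver U (U.codes (pullback (fun j => (t j).1) X)) e.1.sorts fun x =>
      ∃ a : U.Tuple (repSorts t), a ∈ pullback (fun j => (t j).1) X ∧ R x a :=
    .ex (.and (IsDefinableOver.comp (P := (· ∈ pullback (fun j => (t j).1) X)) hX IsTermMap.inr)
      hR.over)
  refine this.congr fun x => ⟨fun hx => ?_, ?_⟩
  · obtain ⟨c, hc⟩ := exists_isRep t
    refine ⟨c, ⟨fun j => ?_, fun c' hc' => ?_⟩, (he c hc x).mp hx⟩
    · change (Quotient.mk (t j).1.rel (fun i => c ⟨j, i⟩) : (t j).1.Elem) ∈ F j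
      rw [show (Quotient.mk (t j).1.rel (fun i => c ⟨j, i⟩) : (t j).1.Elem) = (t j).2 from hc j]
      exact htF j
    · exact he c' fun j => (hc' j).trans (hc j)
  · rintro ⟨a, ha, hx⟩
    exact (ha.2 a (fun _ => rfl) x).mpr hx

theorem exists_tuple_of_isHomeSort {K : L.Sorts} (hK : U.IsHomeSort K) (e : U.Imaginary) :
    ∃ (n : ℕ) (a : U.Tuple fun _ : Fin n => K)
      (R : U.Tuple e.1.sorts → (U.Tuple fun _ : Fin n => K) → Prop),
      IsDefinable U (Sum.elim e.1.sorts fun _ : Fin n => K) (fun d => R (lft d) (rgt d)) ∧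
        ∀ x, x ∈ e.reps ↔ R x a := by
  obtain ⟨m, b, hb, φ, hφ⟩ : e ∈ U.dclEq (Set.range fun a : U.carrier K => U.real a) :=
    hK ▸ Set.mem_univ e
  choose a ha using hb
  -- A real element has exactly one representative, so the imaginary parameters become a tuple of
  -- elements of `K`.
  obtain rfl : (fun j => U.real (a j)) = b := funext ha
  refine ⟨m, a, fun x y => φ.Holds (join x fun p => y p.1), ?_,
    fun x => hφ (fun j _ => a j) (fun j => (mem_reps_real _ _).mpr rfl) x⟩
  exact IsDefinable.comp (P := fun a => φ.Holds a) ⟨φ, fun _ => Iff.rfl⟩ (IsTermMap.inl.join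
    ((IsTermMap.proj (σ := fun _ : Fin m => K)
      fun p : Σ j, Fin (U.real (a j)).1.arity => p.1).comp IsTermMap.inr))

end Structure
end ManySorted

/-! ### Elimination of imaginaries -/

theorem mainTheorem6 {L : ManySorted.Language.{u}} (T : ManySorted.Theory L)
    (U : ManySorted.Structure L) (hU : U.IsMonster T)
    (K : L.Sorts) (hK : U.IsHomeSort K) (G : Set U.EqSort)
    (h_types : ∀ X : Set (U.Tuple (fun _ : Fin 1 => K)), X.Nonempty →
      U.DefinableOver Set.univ X →
      ∃ p : U.GlobalType (fun _ : Fin 1 => K),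
        X ∈ p.sets ∧ p.IsDefinableOver (U.aclEq (U.codes X)))
    (h_codes : ∀ (n : ℕ) (p : U.GlobalType (fun _ : Fin n => K)),
      p.IsDefinableOver Set.univ → U.HasCodeIn p.codes G)
    (h_finite : ∀ (m : ℕ) (S : Fin m → U.EqSort), (∀ j, S j ∈ G) →
      ∀ X : Set (∀ j, (S j).Elem), X.Finite →
        U.HasFiniteCodeIn (U.codes (ManySorted.Structure.pullback S X)) G) :
    U.EliminatesImaginariesIn G := by
  open ManySorted Structure in
  intro e
  obtain ⟨κ, hκ, -, -, -, hsat, hhom⟩ := hU.exists_cardinal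
  obtain ⟨n, a, R, hR, ha⟩ := exists_tuple_of_isHomeSort hK e
  obtain ⟨p, hXp, hp⟩ := exists_definable_type hκ hsat hhom h_types n {e}
    {y | ∀ x, x ∈ e.reps ↔ R x y} ⟨a, ha⟩
    (IsDefinableOver.all (.iff ((isDefinableOver_reps (Set.mem_singleton e)).comp IsTermMap.inr)
      (IsDefinable.over (hR.comp₂ IsTermMap.inr IsTermMap.inl))))
  obtain ⟨B, hBG, hpB, hBp⟩ := h_codes n p (hp.mono (Set.subset_univ _))
  -- The code of `p` is definable from `⌜p⌝`, which is definable over `acl^eq(e)`.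
  have hBe : B ⊆ U.aclEq {e} := (hBp.trans
    (dclEq_trans (GlobalType.codes_subset_dclEq hp))).trans (dclEq_aclEq_subset {e})
  -- The code `B` may be infinite, but the definition of `e` over it uses only a finite tuple `t`.
  obtain ⟨k, t, ht, φ, hφ⟩ := hpB (e.mem_codes_of_mem hR hXp)
  obtain ⟨X, hX, heX⟩ := exists_interdefinable_finite (fun j => hBe (ht j))
    (R := fun x c => φ.Holds (join x c))
    (IsDefinable.comp (P := fun a => φ.Holds a) ⟨φ, fun _ => Iff.rfl⟩
      (IsTermMap.inl.join IsTermMap.inr)) fun c hc => hφ (fun j i => c ⟨j, i⟩) hc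
  obtain ⟨l, s, hs, hXs⟩ := h_finite k (fun j => (t j).1) (fun j => hBG _ (ht j)) X hX
  exact ⟨l, s, hs, heX.trans hXs⟩
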